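/- Notation. For $d\in\mathbb N$ let $B_r(x)=\{y\in\mathbb R^d:|x-y|<r\}$ and $B_r=B_r(0)$. For a domain $\Omega\subset\mathbb R^d$, $s\in[1,\infty)$ and $\lambda\in(0,d/s]$, let $E_{s,\lambda}(\Omega)$ be the Morrey space of all $g\in L_s(\Omega)$ with $$\|g\|_{E_{s,\lambda}(\Omega)}:=\sup_{0<\rho<\infty,\ x\in\Omega}\rho^{\lambda}\Big(\frac1{|B_\rho(x)|}\int_{B_\rho(x)}|g\,I_\Omega|^s\,dy\Big)^{1/s}<\infty ,$$ where $|\Gamma|$ denotes Lebesgue measure, $I_\Omega$ is the indicator function of $\Omega$, and, for vector-valued $g$, $|g|$ is the Euclidean length. Let $E^1_{s,\lambda}(\Omega)$ be the set of real-valued $u\in E_{s,\lambda}(\Omega)$ whose weak (Sobolev) gradient $Du$ exists in $\Omega$ and belongs to $E_{s,\lambda}(\Omega)$. Lemma 4.7. Let $1<p<q<d$, and set $\mu=q/p$ and $q'=pq/(q-p)$. There is a constant $N$, depending only on $d,p,q$, such that for every $R\in(0,\infty)$, every $p'\in[1,q']$ and every $u\in E^1_{p,\mu}(B_R)$ we have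 $u\in E_{p',\mu-1}(B_R)$ and $$\|u\|_{E_{p',\mu-1}(B_R)}\le N\|Du\|_{E_{p,\mu}(B_R)}+NR^{-1}\|u\|_{E_{p,\mu}(B_R)} .$$ -/

import Mathlib

open MeasureTheory Metric Set
open scoped ENNReal NNReal ContDiff

noncomputable section

/-- The normalized norm `(|B_ρ(x)|⁻¹ ∫_{B_ρ(x)} |g I_Ω|^p dy)^{1/p}`; only the values of `g` in `Ω`
matter, and the average is taken over the whole ball `B_ρ(x)`. -/
def avgLpNorm {d : ℕ} {F : Type*} [NormedAddCommGroup F] (p : ℝ)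
    (Ω : Set (EuclideanSpace ℝ (Fin d))) (g : EuclideanSpace ℝ (Fin d) → F)
    (x : EuclideanSpace ℝ (Fin d)) (ρ : ℝ) : ℝ≥0∞ :=
  (⨍⁻ y in ball x ρ, ‖Ω.indicator g y‖ₑ ^ p ∂volume) ^ (1 / p)

/-- The Morrey norm `‖g‖_{E_{p,μ}(Ω)}`: the supremum over `0 < ρ < ∞` and `x ∈ Ω` of
`ρ^μ (|B_ρ(x)|⁻¹ ∫_{B_ρ(x)} |g I_Ω|^p dy)^{1/p}`, as an extended nonnegative number. -/
def morreyNorm {d : ℕ} {F : Type*} [NormedAddCommGroup F] (p μ : ℝ)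
    (Ω : Set (EuclideanSpace ℝ (Fin d))) (g : EuclideanSpace ℝ (Fin d) → F) : ℝ≥0∞ :=
  ⨆ (ρ : ℝ) (_ : 0 < ρ) (x : EuclideanSpace ℝ (Fin d)) (_ : x ∈ Ω),
    ENNReal.ofReal (ρ ^ μ) * avgLpNorm p Ω g x ρ

/-- `g ∈ E_{p,μ}(Ω)`: `g` belongs to `L_p(Ω)` and has finite Morrey norm. -/
structure MemMorrey {d : ℕ} {F : Type*} [NormedAddCommGroup F] (p μ : ℝ)
    (Ω : Set (EuclideanSpace ℝ (Fin d))) (g : EuclideanSpace ℝ (Fin d) → F) : Prop where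
  memLp : MemLp g (ENNReal.ofReal p) (volume.restrict Ω)
  norm_lt_top : morreyNorm p μ Ω g < ⊤

/-- `Du` is the weak (Sobolev) gradient of `u` in the open set `Ω`. -/
structure HasWeakGradient {d : ℕ} (Ω : Set (EuclideanSpace ℝ (Fin d)))
    (u : EuclideanSpace ℝ (Fin d) → ℝ)
    (Du : EuclideanSpace ℝ (Fin d) → EuclideanSpace ℝ (Fin d)) : Prop where
  locallyIntegrableOn : LocallyIntegrableOn u Ω volume
  locallyIntegrableOn_grad : LocallyIntegrableOn Du Ω volume
  integral_eq : ∀ φ : EuclideanSpace ℝ (Fin d) → ℝ, ContDiff ℝ ∞ φ → HasCompactSupport φ →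
    tsupport φ ⊆ Ω → ∀ i : Fin d,
      ∫ x in Ω, u x * fderiv ℝ φ x (EuclideanSpace.single i 1) = - ∫ x in Ω, Du x i * φ x

/-- `u ∈ E¹_{p,μ}(Ω)` with weak gradient `Du`, that is, `u` and `Du` both lie in `E_{p,μ}(Ω)`. -/
structure MemMorreyOne {d : ℕ} (p μ : ℝ) (Ω : Set (EuclideanSpace ℝ (Fin d)))
    (u : EuclideanSpace ℝ (Fin d) → ℝ)
    (Du : EuclideanSpace ℝ (Fin d) → EuclideanSpace ℝ (Fin d)) : Prop where
  memMorrey : MemMorrey p μ Ω u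
  hasWeakGradient : HasWeakGradient Ω u Du
  memMorrey_grad : MemMorrey p μ Ω Du

end

/-! The argument is Adams' embedding by Hedberg's trick, with contractions of the ball in place of a
Poincaré inequality. Fix a smooth probability density η supported in the closed ball of radius R/2.
For x in the ball, average u against η contracted by t towards x: at t = 1 this is the constant c =
∫ u η, the same for every x, and as t → 0 it tends to u(x) at almost every x. Convexity keeps the
contracted weights supported in the ball, so the weak gradient can be tested against them, and the
t-derivative is at most 2R · 8^d times the mean of |Du| over the ball of radius 2Rt about x
(`hasDerivAt_dilationAverage`, `IsBallWeight.enorm_integral_radialTest_le`).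

Write μ = q/p. The mean over radius r is bounded by a maximal function M(x) and by K r^(-μ), where K
bounds the Morrey norm of Du. Using the first bound for r < δ, the second beyond, and optimizing δ
gives |u(x) - c| ≤ C M(x)^(1-1/μ) K^(1/μ) (`IsBallWeight.enorm_sub_rpow_le`). At s = q' one has s(1
- 1/μ) = p, so the s-th power is integrable by the strong (p, p) bound for a localized maximal
function; this yields the Morrey decay of u - c (`IsBallWeight.avgLpNorm_sub_le`). The constant c is
controlled by R⁻¹ times the Morrey norm of u, and smaller exponents p' follow by Jensen. -/

/-! ### The Hardy–Littlewood maximal function. -/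

section MaximalFunction

open Module Filter Topology Measure

/-- The centred Hardy-Littlewood maximal function. -/
noncomputable def hlMaximal {E : Type*} [PseudoMetricSpace E] [MeasurableSpace E] (μ : Measure E) (f : E → ℝ≥0∞) (x : E) : ℝ≥0∞ :=
  ⨆ (r : ℝ) (_ : 0 < r), ⨍⁻ y in ball x r, f y ∂μ

theorem laverage_le_hlMaximal {E : Type*} [PseudoMetricSpace E] [MeasurableSpace E]
    (μ : Measure E) (f : E → ℝ≥0∞) (x : E) {r : ℝ} (hr : 0 < r) :
    ⨍⁻ y in ball x r, f y ∂μ ≤ hlMaximal μ f x :=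
  le_iSup₂ (f := fun (r : ℝ) (_ : 0 < r) => ⨍⁻ y in ball x r, f y ∂μ) r hr

theorem lt_hlMaximal_iff {E : Type*} [PseudoMetricSpace E] [MeasurableSpace E] (μ : Measure E)
    {f : E → ℝ≥0∞} {x : E} {t : ℝ≥0∞} :
    t < hlMaximal μ f x ↔ ∃ r : ℝ, 0 < r ∧ t < ⨍⁻ y in ball x r, f y ∂μ := by
  simp [hlMaximal, lt_iSup_iff]

variable {E : Type*} [NormedAddCommGroup E] [NormedSpace ℝ E] [FiniteDimensional ℝ E]
  [MeasurableSpace E] [BorelSpace E] (μ : Measure E) [IsAddHaarMeasure μ]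

/-- If y is within ε of x, the ball of radius r + ε about y contains the ball of radius r about x,
and its volume tends to that of the smaller ball as ε → 0. No measurability of `f` enters. -/
theorem isOpen_lt_hlMaximal (f : E → ℝ≥0∞) (t : ℝ≥0∞) : IsOpen {x | t < hlMaximal μ f x} := by
  rw [Metric.isOpen_iff]
  intro x hx
  obtain ⟨r, hr, hxr⟩ := (lt_hlMaximal_iff μ).1 hx
  rw [setLAverage_eq] at hxr
  have hbt : μ (ball (0 : E) 1) ≠ ⊤ := measure_ball_lt_top.ne
  have hc : Tendsto (fun ε : ℝ => (∫⁻ y in ball x r, f y ∂μ) /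
      (ENNReal.ofReal ((r + ε) ^ finrank ℝ E) * μ (ball 0 1))) (𝓝 0)
      (𝓝 ((∫⁻ y in ball x r, f y ∂μ) / μ (ball x r))) := by
    rw [addHaar_ball_of_pos μ x hr]
    refine ENNReal.Tendsto.const_div ?_ (Or.inl (ENNReal.mul_ne_top ENNReal.ofReal_ne_top hbt))
    refine ENNReal.Tendsto.mul_const ?_ (Or.inr hbt)
    refine ENNReal.tendsto_ofReal ?_
    have : ContinuousAt (fun ε : ℝ => (r + ε) ^ finrank ℝ E) 0 := by fun_prop
    simpa [ContinuousAt] using this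
  have hev := (hc.eventually (lt_mem_nhds hxr)).filter_mono
    (nhdsWithin_le_nhds (s := Ioi (0 : ℝ)))
  obtain ⟨ε, hε, hε0⟩ := (hev.and self_mem_nhdsWithin).exists
  refine ⟨ε, hε0, fun y hy => (lt_hlMaximal_iff μ).2 ⟨r + ε, add_pos hr hε0, hε.trans_le ?_⟩⟩
  rw [setLAverage_eq, addHaar_ball_of_pos μ y (add_pos hr hε0)]
  gcongr
  apply ball_subset_ball'
  rw [mem_ball, dist_comm] at hy
  linarith

theorem measurable_hlMaximal (f : E → ℝ≥0∞) : Measurable (hlMaximal μ f) :=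
  measurable_of_Ioi fun t => (isOpen_lt_hlMaximal μ f t).measurableSet

/-- The weak type `(1, 1)` bound for the maximal function. -/
theorem mul_measure_lt_hlMaximal_le (f : E → ℝ≥0∞) (t : ℝ≥0∞) (ht : t ≠ 0) :
    t * μ {x | t < hlMaximal μ f x} ≤ 4 ^ finrank ℝ E * ∫⁻ x, f x ∂μ := by
  rcases eq_or_ne (∫⁻ x, f x ∂μ) ⊤ with hf | hf
  · rw [hf, ENNReal.mul_top (by positivity)]; exact le_top
  set S := {x | t < hlMaximal μ f x} with hS
  have hb0 : μ (ball (0 : E) 1) ≠ 0 := (measure_ball_pos μ _ one_pos).ne'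
  rcases eq_or_ne t ⊤ with rfl | htt
  · simp [hS]
  rcases subsingleton_or_nontrivial E with hE | hE
  · -- the space is a point
    rcases S.eq_empty_or_nonempty with h | ⟨x, hx⟩
    · simp [h]
    obtain ⟨r, hr, hxr⟩ := (lt_hlMaximal_iff μ).1 hx
    have hu : ball x r = univ := by
      ext y; simp [Subsingleton.elim y x, hr]
    have hSu : S = univ := by
      ext y; simpa [Subsingleton.elim y x] using hx
    rw [hu, setLAverage_eq, Measure.restrict_univ] at hxr
    rw [hSu, finrank_zero_of_subsingleton, pow_zero, one_mul]
    have h1 : μ univ ≠ ⊤ := by rw [← hu]; exact measure_ball_lt_top.ne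
    have h0 : μ univ ≠ 0 := by rw [← hu]; exact (measure_ball_pos μ _ hr).ne'
    rw [ENNReal.lt_div_iff_mul_lt (Or.inl h0) (Or.inl h1)] at hxr
    exact hxr.le
  choose! r hr0 hr using fun x (hx : x ∈ S) => (lt_hlMaximal_iff μ).1 hx
  have hlt : ∀ x ∈ S, t * μ (closedBall x (r x)) ≤ ∫⁻ y in closedBall x (r x), f y ∂μ := by
    intro x hx
    have h := hr x hx
    rw [setLAverage_eq, ENNReal.lt_div_iff_mul_lt (Or.inl (measure_ball_pos μ _ (hr0 x hx)).ne')
      (Or.inl measure_ball_lt_top.ne)] at h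
    rw [addHaar_closedBall_eq_addHaar_ball]
    exact h.le.trans (lintegral_mono_set ball_subset_closedBall)
  have hn : finrank ℝ E ≠ 0 := finrank_pos.ne'
  -- The Vitali covering needs bounded radii. Finiteness of the integral bounds r^n, hence r,
  -- because r ≤ r^n for r > 1 and n ≥ 1; the one-point space was split off for this reason.
  obtain ⟨R, hR⟩ : ∃ R : ℝ, ∀ x ∈ S, r x ≤ R := by
    set A := (∫⁻ x, f x ∂μ) / (t * μ (ball (0 : E) 1)) with hA
    have hAt : A ≠ ⊤ := (ENNReal.div_lt_top hf (mul_ne_zero ht hb0)).ne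
    refine ⟨max 1 A.toReal, fun x hx => ?_⟩
    by_contra! hlt'
    obtain ⟨h1, h2⟩ := max_lt_iff.1 hlt'
    have h3 : t * (ENNReal.ofReal (r x ^ finrank ℝ E) * μ (ball (0 : E) 1)) ≤ ∫⁻ x, f x ∂μ := by
      rw [← addHaar_closedBall μ x (hr0 x hx).le]
      exact (hlt x hx).trans (setLIntegral_le_lintegral _ _)
    have h4 : ENNReal.ofReal (r x ^ finrank ℝ E) ≤ A := by
      rw [hA, ENNReal.le_div_iff_mul_le (Or.inl (mul_ne_zero ht hb0)) (Or.inr hf)]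
      refine le_trans (le_of_eq ?_) h3
      ring
    have h5 : r x ^ finrank ℝ E ≤ A.toReal := (ENNReal.ofReal_le_iff_le_toReal hAt).1 h4
    have h6 : r x ≤ r x ^ finrank ℝ E := le_self_pow₀ h1.le hn
    linarith
  -- Any enlargement factor above 3 is admissible; 4 produces the constant 4^n.
  obtain ⟨u, huS, hdis, hcov⟩ := Vitali.exists_disjoint_subfamily_covering_enlargement_closedBall
    S id r R hR 4 (by norm_num)
  have hucount : u.Countable := by
    refine hdis.countable_of_nonempty_interior fun x hx => ?_
    refine ⟨x, ball_subset_interior_closedBall (mem_ball_self (hr0 x (huS hx)))⟩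
  have hSsub : S ⊆ ⋃ x ∈ u, closedBall x (4 * r x) := by
    intro x hx
    obtain ⟨b, hb, hxb⟩ := hcov x hx
    exact mem_biUnion hb (hxb (mem_closedBall_self (hr0 x hx).le))
  have := hucount.to_subtype
  calc t * μ S ≤ t * ∑' x : u, μ (closedBall (x : E) (4 * r x)) := by
        gcongr
        exact (measure_mono hSsub).trans (measure_biUnion_le μ hucount _)
    _ = ∑' x : u, 4 ^ finrank ℝ E * (t * μ (closedBall (x : E) (r x))) := by
        rw [← ENNReal.tsum_mul_left]
        refine tsum_congr fun x => ?_
        have hx := (hr0 x (huS x.2)).le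
        rw [addHaar_closedBall μ _ (by positivity), addHaar_closedBall μ _ hx, mul_pow,
          ENNReal.ofReal_mul (by positivity), ENNReal.ofReal_pow (by norm_num)]
        simp only [ENNReal.ofReal_ofNat]
        ring
    _ ≤ ∑' x : u, 4 ^ finrank ℝ E * ∫⁻ y in closedBall (x : E) (r x), f y ∂μ := by
        gcongr with x
        exact hlt x (huS x.2)
    _ = 4 ^ finrank ℝ E * ∫⁻ y in ⋃ x ∈ u, closedBall x (r x), f y ∂μ := by
        rw [ENNReal.tsum_mul_left, lintegral_biUnion (s := fun x => closedBall x (r x)) hucount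
          (fun x _ => measurableSet_closedBall) hdis]
    _ ≤ 4 ^ finrank ℝ E * ∫⁻ x, f x ∂μ := by
        gcongr
        exact Measure.restrict_le_self

theorem lintegral_Ioi_ite_rpow_coe {r : ℝ} (hr : 0 < r) (c : ℝ≥0) :
    ∫⁻ t in Ioi (0 : ℝ), (if ENNReal.ofReal t < c then ENNReal.ofReal (t ^ (r - 1)) else 0) =
      (c : ℝ≥0∞) ^ r / ENNReal.ofReal r := by
  have h1 : ∀ t ∈ Ioi (0 : ℝ),
      (if ENNReal.ofReal t < c then ENNReal.ofReal (t ^ (r - 1)) else 0) =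
      (Iio (c : ℝ)).indicator (fun t => ENNReal.ofReal (t ^ (r - 1))) t := by
    intro t ht
    have : ENNReal.ofReal t < c ↔ t < c := by
      rw [← ENNReal.ofReal_coe_nnreal, ENNReal.ofReal_lt_ofReal_iff_of_nonneg (le_of_lt ht)]
    simp [indicator, this]
  rw [setLIntegral_congr_fun measurableSet_Ioi h1, lintegral_indicator measurableSet_Iio,
    Measure.restrict_restrict measurableSet_Iio, Iio_inter_Ioi, restrict_congr_set Ioo_ae_eq_Ioc]
  have hint : IntervalIntegrable (fun t : ℝ => t ^ (r - 1)) volume 0 c :=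
    intervalIntegral.intervalIntegrable_rpow' (by linarith)
  rw [← ofReal_integral_eq_lintegral_ofReal
    ((intervalIntegrable_iff_integrableOn_Ioc_of_le c.coe_nonneg).1 hint)
    ((ae_restrict_iff' measurableSet_Ioc).2 (ae_of_all _ fun t ht =>
      Real.rpow_nonneg ht.1.le _)),
    ← intervalIntegral.integral_of_le c.coe_nonneg, integral_rpow (Or.inl (by linarith))]
  rw [sub_add_cancel, Real.zero_rpow hr.ne', sub_zero, ENNReal.ofReal_div_of_pos hr,
    ← ENNReal.ofReal_rpow_of_nonneg c.coe_nonneg hr.le, ENNReal.ofReal_coe_nnreal]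

/-- The layer-cake representation of a power of an extended nonnegative number. -/
theorem lintegral_Ioi_ite_rpow {r : ℝ} (hr : 0 < r) (a : ℝ≥0∞) :
    ∫⁻ t in Ioi (0 : ℝ), (if ENNReal.ofReal t < a then ENNReal.ofReal (t ^ (r - 1)) else 0) =
      a ^ r / ENNReal.ofReal r := by
  induction a with
  | coe c => exact lintegral_Ioi_ite_rpow_coe hr c
  | top =>
    rw [ENNReal.top_rpow_of_pos hr, ENNReal.top_div_of_ne_top ENNReal.ofReal_ne_top]
    refine top_le_iff.1 (ENNReal.le_of_forall_nnreal_lt fun b _ => ?_)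
    -- This level makes the finite case equal to b, so the integral for ⊤ is at least every finite
    -- b.
    have h := lintegral_Ioi_ite_rpow_coe hr ((b * r.toNNReal) ^ (1 / r))
    rw [← ENNReal.coe_rpow_of_nonneg _ hr.le, ← NNReal.rpow_mul, one_div_mul_cancel hr.ne',
      NNReal.rpow_one, ENNReal.coe_mul, ENNReal.ofReal, ENNReal.mul_div_cancel_right
        (by simpa using hr) ENNReal.coe_ne_top] at h
    rw [← h]
    refine lintegral_mono fun t => ?_
    split_ifs with h1 h2
    · rfl
    · exact absurd ENNReal.ofReal_lt_top h2
    · exact zero_le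
    · rfl

/-- The part of `f` not above t/2 adds at most t/2 to any average, so the part above t/2 must have
maximal function above t/2; the weak bound is applied to that part only. -/
theorem measure_lt_hlMaximal_le {f : E → ℝ≥0∞} (hf : Measurable f) {t : ℝ} (ht : 0 < t) :
    μ {x | ENNReal.ofReal t < hlMaximal μ f x} ≤ 2 * 4 ^ finrank ℝ E * (ENNReal.ofReal t)⁻¹ *
      ∫⁻ x, {x | ENNReal.ofReal t < 2 * f x}.indicator f x ∂μ := by
  set T := ENNReal.ofReal t with hT
  have hT0 : T ≠ 0 := by simpa [hT] using ht
  have hTt : T ≠ ⊤ := ENNReal.ofReal_ne_top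
  set g := {x | T < 2 * f x}.indicator f with hg
  have hgm : Measurable g :=
    hf.indicator (measurableSet_lt measurable_const (hf.const_mul 2))
  have hle : ∀ x, f x ≤ g x + T / 2 := by
    intro x
    by_cases hx : T < 2 * f x
    · simp [hg, hx]
    · rw [not_lt, mul_comm] at hx
      exact (ENNReal.le_div_iff_mul_le (by simp) (by simp) |>.2 hx).trans le_add_self
  have hsub : {x | T < hlMaximal μ f x} ⊆ {x | T / 2 < hlMaximal μ g x} := by
    intro x hx
    obtain ⟨r, hr, hxr⟩ := (lt_hlMaximal_iff μ).1 hx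
    refine (lt_hlMaximal_iff μ).2 ⟨r, hr, ?_⟩
    have h1 : ⨍⁻ y in ball x r, f y ∂μ ≤ ⨍⁻ y in ball x r, g y ∂μ + T / 2 := by
      calc ⨍⁻ y in ball x r, f y ∂μ ≤ ⨍⁻ y in ball x r, (g y + T / 2) ∂μ :=
            lintegral_mono hle
        _ = ⨍⁻ y in ball x r, g y ∂μ + ⨍⁻ y in ball x r, T / 2 ∂μ :=
            lintegral_add_left hgm _
        _ = _ := by
            rw [setLAverage_const (measure_ball_pos μ _ hr).ne' measure_ball_lt_top.ne]
    have h2 : T / 2 + T / 2 < ⨍⁻ y in ball x r, g y ∂μ + T / 2 := by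
      rw [ENNReal.add_halves]; exact hxr.trans_le h1
    exact lt_of_add_lt_add_right h2
  have h3 := mul_measure_lt_hlMaximal_le μ g (T / 2) (by simp [hT0])
  calc μ {x | T < hlMaximal μ f x} ≤ μ {x | T / 2 < hlMaximal μ g x} := measure_mono hsub
    _ ≤ (4 ^ finrank ℝ E * ∫⁻ x, g x ∂μ) / (T / 2) := by
        rw [ENNReal.le_div_iff_mul_le (Or.inl (by simp [hT0]))
          (Or.inl (ENNReal.div_lt_top hTt (by simp)).ne), mul_comm]
        exact h3
    _ = _ := by
        rw [div_eq_mul_inv, ENNReal.inv_div (by simp) (by simp), div_eq_mul_inv]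
        ring

/-- The strong type `(p, p)` bound for the maximal function, `1 < p < ∞`. -/
theorem lintegral_hlMaximal_rpow_le {p : ℝ} (hp : 1 < p) {f : E → ℝ≥0∞} (hf : Measurable f) :
    ∫⁻ x, hlMaximal μ f x ^ p ∂μ ≤
      (ENNReal.ofReal p * (2 * 4 ^ finrank ℝ E) * (2 ^ (p - 1) / ENNReal.ofReal (p - 1))) *
        ∫⁻ x, f x ^ p ∂μ := by
  have hp0 : 0 < p := by linarith
  have hM := measurable_hlMaximal μ f
  have hpne : ENNReal.ofReal p ≠ 0 := by simpa using hp0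
  have h1 : ∀ x, hlMaximal μ f x ^ p = ENNReal.ofReal p * ∫⁻ t in Ioi (0 : ℝ),
      (if ENNReal.ofReal t < hlMaximal μ f x then ENNReal.ofReal (t ^ (p - 1)) else 0) := by
    intro x
    rw [lintegral_Ioi_ite_rpow hp0, ENNReal.mul_div_cancel hpne ENNReal.ofReal_ne_top]
  have hm1 : Measurable fun z : E × ℝ =>
      (if ENNReal.ofReal z.2 < hlMaximal μ f z.1 then ENNReal.ofReal (z.2 ^ (p - 1)) else 0) := by
    refine Measurable.ite (measurableSet_lt (by fun_prop) (by fun_prop)) (by fun_prop)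
      measurable_const
  have hm2 : Measurable fun z : ℝ × E =>
      f z.2 * (if ENNReal.ofReal z.1 < 2 * f z.2 then ENNReal.ofReal (z.1 ^ (p - 1 - 1)) else 0) := by
    refine Measurable.mul (by fun_prop) (Measurable.ite
      (measurableSet_lt (by fun_prop) (by fun_prop)) (by fun_prop) measurable_const)
  -- Marcinkiewicz interpolation: layer cake, the truncated weak bound at each level, Tonelli, and
  -- layer cake again with exponent p - 1 > 0.
  calc ∫⁻ x, hlMaximal μ f x ^ p ∂μ
      = ENNReal.ofReal p * ∫⁻ t in Ioi (0 : ℝ), ∫⁻ x, (if ENNReal.ofReal t < hlMaximal μ f x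
          then ENNReal.ofReal (t ^ (p - 1)) else 0) ∂μ := by
        simp_rw [h1]
        rw [lintegral_const_mul' _ _ ENNReal.ofReal_ne_top,
          lintegral_lintegral_swap hm1.aemeasurable]
    _ ≤ ENNReal.ofReal p * ∫⁻ t in Ioi (0 : ℝ), 2 * 4 ^ finrank ℝ E * ∫⁻ x, f x *
          (if ENNReal.ofReal t < 2 * f x then ENNReal.ofReal (t ^ (p - 1 - 1)) else 0) ∂μ := by
        gcongr ENNReal.ofReal p * ?_
        refine setLIntegral_mono' measurableSet_Ioi fun t ht => ?_
        have ht : 0 < t := ht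
        have e1 : ∫⁻ x, (if ENNReal.ofReal t < hlMaximal μ f x
            then ENNReal.ofReal (t ^ (p - 1)) else 0) ∂μ =
            ENNReal.ofReal (t ^ (p - 1)) * μ {x | ENNReal.ofReal t < hlMaximal μ f x} := by
          rw [← lintegral_indicator_const (isOpen_lt_hlMaximal μ f _).measurableSet]
          refine lintegral_congr fun x => ?_
          simp [indicator]
        have e2 : ∀ x, f x * (if ENNReal.ofReal t < 2 * f x
            then ENNReal.ofReal (t ^ (p - 1 - 1)) else 0) =
            ENNReal.ofReal (t ^ (p - 1 - 1)) *
              {x | ENNReal.ofReal t < 2 * f x}.indicator f x := by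
          intro x
          by_cases hx : ENNReal.ofReal t < 2 * f x
          · rw [if_pos hx, indicator_of_mem (show x ∈ {x | ENNReal.ofReal t < 2 * f x} from hx),
              mul_comm]
          · rw [if_neg hx, indicator_of_notMem (show x ∉ {x | ENNReal.ofReal t < 2 * f x} from hx),
              mul_zero, mul_zero]
        have e3 : ENNReal.ofReal (t ^ (p - 1)) * (ENNReal.ofReal t)⁻¹ =
            ENNReal.ofReal (t ^ (p - 1 - 1)) := by
          rw [← ENNReal.ofReal_inv_of_pos ht, ← ENNReal.ofReal_mul (by positivity),
            Real.rpow_sub_one ht.ne' (p - 1), div_eq_mul_inv]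
        rw [e1]
        simp_rw [e2]
        rw [lintegral_const_mul' _ _ ENNReal.ofReal_ne_top, ← e3]
        calc _ ≤ ENNReal.ofReal (t ^ (p - 1)) * (2 * 4 ^ finrank ℝ E * (ENNReal.ofReal t)⁻¹ *
                ∫⁻ x, {x | ENNReal.ofReal t < 2 * f x}.indicator f x ∂μ) := by
              gcongr; exact measure_lt_hlMaximal_le μ hf ht
          _ = _ := by ring
    _ = ENNReal.ofReal p * (2 * 4 ^ finrank ℝ E) * ∫⁻ x, (f x * ∫⁻ t in Ioi (0 : ℝ),
          (if ENNReal.ofReal t < 2 * f x then ENNReal.ofReal (t ^ (p - 1 - 1)) else 0)) ∂μ := by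
        rw [lintegral_const_mul' _ _ (by finiteness), lintegral_lintegral_swap hm2.aemeasurable,
          ← mul_assoc]
        refine congrArg _ (lintegral_congr fun x => ?_)
        rw [lintegral_const_mul]
        exact Measurable.ite (measurableSet_lt (by fun_prop) (by fun_prop)) (by fun_prop)
          measurable_const
    _ = ENNReal.ofReal p * (2 * 4 ^ finrank ℝ E) *
          ∫⁻ x, 2 ^ (p - 1) / ENNReal.ofReal (p - 1) * f x ^ p ∂μ := by
        refine congrArg _ (lintegral_congr fun x => ?_)
        rw [lintegral_Ioi_ite_rpow (by linarith : 0 < p - 1),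
          ENNReal.mul_rpow_of_nonneg _ _ (by linarith : 0 ≤ p - 1), div_eq_mul_inv,
          div_eq_mul_inv]
        have : f x ^ p = f x * f x ^ (p - 1) := by
          conv_rhs => rw [← ENNReal.rpow_one (f x), ← ENNReal.rpow_mul, one_mul,
            ← ENNReal.rpow_add_of_nonneg _ _ zero_le_one (by linarith : 0 ≤ p - 1)]
          congr 1; ring
        rw [this]; ring
    _ = _ := by
        rw [lintegral_const_mul _ (hf.pow_const p), ← mul_assoc]

end MaximalFunction

/-! ### Averages against contracted weights and their derivative in t. -/

section DilationAverage

open Filter Topology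

variable {d : ℕ}

/-- The average of `u` over `Ω` against the weight `η` contracted by the factor `t` towards `x`. -/
noncomputable def dilationAverage (Ω : Set (EuclideanSpace ℝ (Fin d)))
    (η u : EuclideanSpace ℝ (Fin d) → ℝ) (x : EuclideanSpace ℝ (Fin d)) (t : ℝ) : ℝ :=
  ∫ y in Ω, u y * (t⁻¹ ^ d * η (x + t⁻¹ • (y - x)))

/-- The divergence of `w ↦ η w • (w - x)`. -/
noncomputable def radialDivergence (η : EuclideanSpace ℝ (Fin d) → ℝ)
    (x w : EuclideanSpace ℝ (Fin d)) : ℝ :=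
  d * η w + fderiv ℝ η w (w - x)

variable {η : EuclideanSpace ℝ (Fin d) → ℝ}

theorem continuous_radialDivergence (hη : ContDiff ℝ ∞ η) (x : EuclideanSpace ℝ (Fin d)) :
    Continuous (radialDivergence η x) := by
  have h1 := hη.continuous
  have h2 := hη.continuous_fderiv (by simp)
  unfold radialDivergence
  fun_prop

theorem exists_abs_radialDivergence_le (hη : ContDiff ℝ ∞ η) (hc : HasCompactSupport η)
    (x : EuclideanSpace ℝ (Fin d)) : ∃ C, ∀ w, |radialDivergence η x w| ≤ C := by
  have hs : HasCompactSupport (radialDivergence η x) := by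
    refine HasCompactSupport.intro hc fun w hw => ?_
    rw [radialDivergence, image_eq_zero_of_notMem_tsupport hw,
      image_eq_zero_of_notMem_tsupport fun h => hw (tsupport_fderiv_subset ℝ h)]
    simp
  exact hs.exists_bound_of_continuous (continuous_radialDivergence hη x)

theorem hasDerivAt_dilation (hd : d ≠ 0) (hη : ContDiff ℝ ∞ η) (x y : EuclideanSpace ℝ (Fin d))
    {t : ℝ} (ht : t ≠ 0) :
    HasDerivAt (fun s : ℝ => s⁻¹ ^ d * η (x + s⁻¹ • (y - x)))
      (-(t⁻¹ ^ (d + 1) * radialDivergence η x (x + t⁻¹ • (y - x)))) t := by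
  have hinv : HasDerivAt (fun s : ℝ => s⁻¹) (-(t ^ 2)⁻¹) t := hasDerivAt_inv ht
  have h1 : HasDerivAt (fun s : ℝ => x + s⁻¹ • (y - x)) ((-(t ^ 2)⁻¹) • (y - x)) t :=
    (hinv.smul_const (y - x)).const_add x
  have h2 : HasFDerivAt η (fderiv ℝ η (x + t⁻¹ • (y - x))) (x + t⁻¹ • (y - x)) :=
    (hη.differentiable (by simp) _).hasFDerivAt
  have h3 := (hinv.pow d).mul (h2.comp_hasDerivAt t h1)
  refine h3.congr_deriv ?_
  obtain ⟨n, rfl⟩ := Nat.exists_eq_succ_of_ne_zero hd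
  simp only [radialDivergence, map_smul, smul_eq_mul, add_sub_cancel_left, Nat.succ_eq_add_one,
    Nat.add_sub_cancel, Pi.pow_apply, Function.comp_apply]
  rw [← inv_pow]
  push_cast
  ring

/-- The coordinates of the dilated radial vector field, used as test functions. -/
noncomputable def radialTest (η : EuclideanSpace ℝ (Fin d) → ℝ) (x : EuclideanSpace ℝ (Fin d))
    (t : ℝ) (i : Fin d) (y : EuclideanSpace ℝ (Fin d)) : ℝ :=
  (y - x) i * (t⁻¹ ^ (d + 1) * η (x + t⁻¹ • (y - x)))

theorem contDiff_radialTest (hη : ContDiff ℝ ∞ η) (x : EuclideanSpace ℝ (Fin d)) (t : ℝ)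
    (i : Fin d) : ContDiff ℝ ∞ (radialTest η x t i) := by
  have h1 : ContDiff ℝ ∞ fun y : EuclideanSpace ℝ (Fin d) => (y - x) i :=
    (EuclideanSpace.proj (𝕜 := ℝ) i).contDiff.comp (contDiff_id.sub contDiff_const)
  have h2 : ContDiff ℝ ∞ fun y : EuclideanSpace ℝ (Fin d) => x + t⁻¹ • (y - x) := by fun_prop
  exact h1.mul (contDiff_const.mul (hη.comp h2))

/-- Together with `hasDerivAt_dilation` this is the continuity equation: contraction transports the
weight along the radial field, so its t-derivative is minus a divergence in y, ready for integration
by parts. -/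
theorem sum_fderiv_radialTest (hη : ContDiff ℝ ∞ η) (x y : EuclideanSpace ℝ (Fin d)) (t : ℝ) :
    ∑ i, fderiv ℝ (radialTest η x t i) y (EuclideanSpace.single i 1) =
      t⁻¹ ^ (d + 1) * radialDivergence η x (x + t⁻¹ • (y - x)) := by
  set w := x + t⁻¹ • (y - x) with hw
  have h2 : HasFDerivAt η (fderiv ℝ η w) w := (hη.differentiable (by simp) _).hasFDerivAt
  have h1 : HasFDerivAt (fun y : EuclideanSpace ℝ (Fin d) => x + t⁻¹ • (y - x))
      (t⁻¹ • ContinuousLinearMap.id ℝ _) y :=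
    (((hasFDerivAt_id y).sub_const x).const_smul t⁻¹).const_add x
  have h4 : ∀ i, fderiv ℝ (radialTest η x t i) y (EuclideanSpace.single i 1) =
      t⁻¹ ^ (d + 1) * η w + t⁻¹ ^ (d + 1) * t⁻¹ *
        ((y - x) i * fderiv ℝ η w (EuclideanSpace.single i 1)) := by
    intro i
    have h3 : HasFDerivAt (fun y : EuclideanSpace ℝ (Fin d) => (y - x) i)
        (EuclideanSpace.proj (𝕜 := ℝ) i) y :=
      ((EuclideanSpace.proj (𝕜 := ℝ) i).hasFDerivAt).comp y ((hasFDerivAt_id y).sub_const x)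
    have h5 := h3.mul ((h2.comp y h1).const_mul (t⁻¹ ^ (d + 1)))
    have h6 : HasFDerivAt (radialTest η x t i) _ y := h5
    rw [h6.fderiv]
    simp [← hw]
    ring
  have h7 : y - x = ∑ i, (y - x) i • EuclideanSpace.single i (1 : ℝ) := by
    ext j
    simp [Finset.sum_apply, Pi.single_apply]
  have h8 : fderiv ℝ η w (w - x) =
      t⁻¹ * ∑ i, (y - x) i * fderiv ℝ η w (EuclideanSpace.single i 1) := by
    rw [hw, add_sub_cancel_left, map_smul, ← hw]
    conv_lhs => rw [h7]
    simp [map_sum]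
  simp_rw [h4]
  rw [Finset.sum_add_distrib, Finset.sum_const, ← Finset.mul_sum, radialDivergence, h8,
    Finset.card_univ, Fintype.card_fin, nsmul_eq_mul]
  ring

theorem hasCompactSupport_dilation (hc : HasCompactSupport η) (x : EuclideanSpace ℝ (Fin d))
    {t : ℝ} (ht : t ≠ 0) : HasCompactSupport fun y => η (x + t⁻¹ • (y - x)) := by
  have := hc.comp_homeomorph (((Homeomorph.subRight x).trans
    (Homeomorph.smulOfNeZero t⁻¹ (inv_ne_zero ht))).trans (Homeomorph.addLeft x))
  exact this

theorem hasCompactSupport_radialTest (hc : HasCompactSupport η) (x : EuclideanSpace ℝ (Fin d))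
    {t : ℝ} (ht : t ≠ 0) (i : Fin d) : HasCompactSupport (radialTest η x t i) :=
  ((hasCompactSupport_dilation hc x ht).mul_left (f := fun _ => t⁻¹ ^ (d + 1))).mul_left
    (f := fun y => (y - x) i)

theorem tsupport_radialTest_subset (x : EuclideanSpace ℝ (Fin d)) (t : ℝ) (i : Fin d) :
    tsupport (radialTest η x t i) ⊆ tsupport fun y => η (x + t⁻¹ • (y - x)) :=
  closure_mono fun y hy => by
    rw [Function.mem_support] at hy ⊢
    exact right_ne_zero_of_mul (right_ne_zero_of_mul hy)

theorem hasDerivAt_dilationAverage (hd : d ≠ 0) {Ω : Set (EuclideanSpace ℝ (Fin d))}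
    {u : EuclideanSpace ℝ (Fin d) → ℝ} {Du : EuclideanSpace ℝ (Fin d) → EuclideanSpace ℝ (Fin d)}
    (hu : IntegrableOn u Ω) (hDu : IntegrableOn Du Ω) (hw : HasWeakGradient Ω u Du)
    (hη : ContDiff ℝ ∞ η) (hc : HasCompactSupport η) (x : EuclideanSpace ℝ (Fin d))
    {t : ℝ} (ht : 0 < t) (hsupp : tsupport (fun y => η (x + t⁻¹ • (y - x))) ⊆ Ω) :
    HasDerivAt (dilationAverage Ω η u x) (∫ y in Ω, ∑ i, Du y i * radialTest η x t i y) t := by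
  obtain ⟨C, hC⟩ := exists_abs_radialDivergence_le hη hc x
  have hcont : ∀ s : ℝ, Continuous fun y => s⁻¹ ^ d * η (x + s⁻¹ • (y - x)) := fun s => by
    have := hη.continuous
    fun_prop
  obtain ⟨Cη, hCη⟩ := hc.exists_bound_of_continuous hη.continuous
  have hder := (hasDerivAt_integral_of_dominated_loc_of_deriv_le (μ := volume.restrict Ω)
    (F := fun s y => u y * (s⁻¹ ^ d * η (x + s⁻¹ • (y - x))))
    (F' := fun s y => u y * (-(s⁻¹ ^ (d + 1) * radialDivergence η x (x + s⁻¹ • (y - x)))))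
    -- Restricting to s > t/2 keeps s^(-(d+1)) bounded.
    (bound := fun y => ‖u y‖ * ((t / 2)⁻¹ ^ (d + 1) * C))
    (Ioi_mem_nhds (half_lt_self ht)) (Eventually.of_forall fun s =>
      hu.aestronglyMeasurable.mul (hcont s).aestronglyMeasurable) ?_ ?_ ?_ ?_ ?_).2
  · refine hder.congr_deriv ?_
    have hbd : ∀ i, Integrable (fun y => u y *
        fderiv ℝ (radialTest η x t i) y (EuclideanSpace.single i 1)) (volume.restrict Ω) := by
      intro i
      have hcd := contDiff_radialTest hη x t i
      have hcf : Continuous fun y =>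
          fderiv ℝ (radialTest η x t i) y (EuclideanSpace.single i 1) :=
        (hcd.continuous_fderiv (by simp)).clm_apply continuous_const
      obtain ⟨B, hB⟩ := ((hasCompactSupport_radialTest hc x ht.ne' i).fderiv_apply (𝕜 := ℝ)
        (EuclideanSpace.single i 1)).exists_bound_of_continuous hcf
      exact hu.mul_bdd hcf.aestronglyMeasurable (ae_of_all _ hB)
    have hbd' : ∀ i, Integrable (fun y => Du y i * radialTest η x t i y)
        (volume.restrict Ω) := by
      intro i
      have hcf := (contDiff_radialTest hη x t i).continuous
      obtain ⟨B, hB⟩ :=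
        (hasCompactSupport_radialTest hc x ht.ne' i).exists_bound_of_continuous hcf
      exact ((EuclideanSpace.proj (𝕜 := ℝ) i).integrable_comp hDu).mul_bdd
        hcf.aestronglyMeasurable (ae_of_all _ hB)
    simp_rw [← sum_fderiv_radialTest hη, mul_neg, Finset.mul_sum]
    rw [integral_neg, integral_finsetSum _ fun i _ => hbd i,
      integral_finsetSum _ fun i _ => hbd' i, ← Finset.sum_neg_distrib]
    refine Finset.sum_congr rfl fun i _ => ?_
    rw [hw.integral_eq _ (contDiff_radialTest hη x t i)
      (hasCompactSupport_radialTest hc x ht.ne' i)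
      ((tsupport_radialTest_subset x t i).trans hsupp), neg_neg]
  · refine hu.mul_bdd (c := t⁻¹ ^ d * Cη) (hcont t).aestronglyMeasurable (ae_of_all _ fun y => ?_)
    rw [norm_mul, Real.norm_of_nonneg (by positivity)]
    gcongr
    exact hCη _
  · have := continuous_radialDivergence hη x
    refine hu.aestronglyMeasurable.mul (Continuous.aestronglyMeasurable ?_)
    fun_prop
  · refine ae_of_all _ fun y s hs => ?_
    have hs' : t / 2 < s := hs
    have h0 : 0 < s := by linarith
    rw [norm_mul, norm_neg, norm_mul, Real.norm_of_nonneg (by positivity : 0 ≤ s⁻¹ ^ (d + 1))]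
    gcongr
    exact hC _
  · exact hu.norm.mul_const _
  · refine ae_of_all _ fun y s hs => ?_
    have hs' : t / 2 < s := hs
    exact (hasDerivAt_dilation hd hη x y (by linarith : s ≠ 0)).const_mul (u y)

end DilationAverage

/-! ### Estimates for the averages along the contraction. -/

section PointwiseEstimate

open Filter Topology

/-- A smooth probability density supported in the half-radius ball and bounded by a multiple of
`|B_R|⁻¹`. -/
structure IsBallWeight {d : ℕ} (R : ℝ) (η : EuclideanSpace ℝ (Fin d) → ℝ) : Prop where
  contDiff : ContDiff ℝ ∞ η
  tsupport_subset : tsupport η ⊆ closedBall 0 (R / 2)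
  nonneg : ∀ w, 0 ≤ η w
  le : ∀ w, η w ≤ 4 ^ d / volume.real (ball (0 : EuclideanSpace ℝ (Fin d)) R)
  integral_eq_one : ∫ w, η w = 1

/-- A normalized bump with inner radius R/4 is at most 1/|B_{R/4}|, which is the source of the 4^d.
-/
theorem exists_isBallWeight (d : ℕ) {R : ℝ} (hR : 0 < R) :
    ∃ η : EuclideanSpace ℝ (Fin d) → ℝ, IsBallWeight R η := by
  let f : ContDiffBump (0 : EuclideanSpace ℝ (Fin d)) :=
    ⟨R / 4, R / 2, by positivity, by linarith⟩
  refine ⟨f.normed volume, f.contDiff_normed, ?_, f.nonneg_normed, fun w => ?_, f.integral_normed⟩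
  · rw [f.tsupport_normed_eq]
  · refine (f.normed_le_div_measure_closedBall_rIn volume w).trans (le_of_eq ?_)
    have h1 : volume.real (closedBall (0 : EuclideanSpace ℝ (Fin d)) (R / 4)) =
        (R / 4) ^ d * volume.real (ball (0 : EuclideanSpace ℝ (Fin d)) 1) := by
      rw [Measure.addHaar_real_closedBall _ _ (by positivity), finrank_euclideanSpace_fin]
    have h2 : volume.real (ball (0 : EuclideanSpace ℝ (Fin d)) R) =
        R ^ d * volume.real (ball (0 : EuclideanSpace ℝ (Fin d)) 1) := by
      rw [measureReal_def, Measure.addHaar_ball_of_pos _ _ hR, finrank_euclideanSpace_fin,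
        ENNReal.toReal_mul, ENNReal.toReal_ofReal (by positivity), measureReal_def]
    have h3 : 0 < volume.real (ball (0 : EuclideanSpace ℝ (Fin d)) 1) :=
      ENNReal.toReal_pos (measure_ball_pos _ _ one_pos).ne' measure_ball_lt_top.ne
    change 1 / volume.real (closedBall (0 : EuclideanSpace ℝ (Fin d)) (R / 4)) = _
    rw [h1, h2, div_pow]
    field_simp

variable {d : ℕ} {R : ℝ} {η : EuclideanSpace ℝ (Fin d) → ℝ} {x : EuclideanSpace ℝ (Fin d)}

theorem IsBallWeight.hasCompactSupport (hη : IsBallWeight R η) : HasCompactSupport η :=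
  (isCompact_closedBall _ _).of_isClosed_subset (isClosed_tsupport η) hη.tsupport_subset

/-- A support point is y = (1 - t)x + tw with |w| ≤ R/2: convexity keeps it in the ball, and |y - x|
= t|w - x| < 2Rt. -/
theorem IsBallWeight.tsupport_dilation_subset (hη : IsBallWeight R η) (hx : x ∈ ball 0 R)
    {t : ℝ} (ht0 : 0 < t) (ht1 : t ≤ 1) :
    tsupport (fun y => η (x + t⁻¹ • (y - x))) ⊆ ball 0 R ∩ ball x (2 * R * t) := by
  intro y hy
  have hcont : Continuous fun y : EuclideanSpace ℝ (Fin d) => x + t⁻¹ • (y - x) := by fun_prop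
  have hw := hη.tsupport_subset (tsupport_comp_subset_preimage η hcont hy)
  rw [mem_closedBall_zero_iff] at hw
  rw [mem_ball_zero_iff] at hx
  set w := x + t⁻¹ • (y - x) with hwdef
  have hyw : y - x = t • (w - x) := by
    rw [hwdef, add_sub_cancel_left, smul_inv_smul₀ ht0.ne']
  have hR : 0 < R := (norm_nonneg x).trans_lt hx
  constructor
  · rw [mem_ball_zero_iff]
    have h1 : y = (1 - t) • x + t • w := by
      rw [smul_sub] at hyw
      rw [sub_smul, one_smul, ← sub_add_cancel y x, hyw]; abel
    have h2 : ‖y‖ ≤ (1 - t) * ‖x‖ + t * ‖w‖ := by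
      rw [h1]
      refine (norm_add_le _ _).trans (le_of_eq ?_)
      rw [norm_smul, norm_smul, Real.norm_of_nonneg (by linarith), Real.norm_of_nonneg ht0.le]
    nlinarith [mul_le_mul_of_nonneg_left hx.le (by linarith : 0 ≤ 1 - t),
      mul_le_mul_of_nonneg_left hw ht0.le, mul_pos ht0 hR]
  · rw [mem_ball, dist_eq_norm, hyw, norm_smul, Real.norm_of_nonneg ht0.le]
    have h3 : ‖w - x‖ < 2 * R := by
      refine (norm_sub_le _ _).trans_lt ?_
      linarith
    nlinarith [mul_lt_mul_of_pos_left h3 ht0]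

/-- Integration against a dilated weight is controlled by an average over a ball. -/
theorem IsBallWeight.lintegral_dilation_le (hη : IsBallWeight R η) (hx : x ∈ ball 0 R)
    {t : ℝ} (ht0 : 0 < t) (ht1 : t ≤ 1) {F : Type*} [NormedAddCommGroup F]
    (g : EuclideanSpace ℝ (Fin d) → F) :
    ∫⁻ y in ball 0 R, ‖g y‖ₑ * ENNReal.ofReal (t⁻¹ ^ d * η (x + t⁻¹ • (y - x))) ≤
      8 ^ d * ⨍⁻ y in ball x (2 * R * t), ‖(ball 0 R).indicator g y‖ₑ ∂volume := by
  have hR : 0 < R := by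
    rw [mem_ball_zero_iff] at hx; exact (norm_nonneg x).trans_lt hx
  set V := volume (ball (0 : EuclideanSpace ℝ (Fin d)) R) with hV
  have hV0 : V ≠ 0 := (measure_ball_pos _ _ hR).ne'
  have hVt : V ≠ ⊤ := measure_ball_lt_top.ne
  have hVr : 0 < volume.real (ball (0 : EuclideanSpace ℝ (Fin d)) R) := ENNReal.toReal_pos hV0 hVt
  have hvol : volume (ball x (2 * R * t)) = ENNReal.ofReal ((2 * t) ^ d) * V := by
    rw [hV, show 2 * R * t = (2 * t) * R by ring,
      Measure.addHaar_ball_mul_of_pos _ _ (by positivity), finrank_euclideanSpace_fin]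
  have hpt : ∀ y ∈ ball (0 : EuclideanSpace ℝ (Fin d)) R,
      ‖g y‖ₑ * ENNReal.ofReal (t⁻¹ ^ d * η (x + t⁻¹ • (y - x))) ≤
      (ball x (2 * R * t)).indicator (fun y => ENNReal.ofReal (t⁻¹ ^ d * (4 ^ d / V.toReal)) *
        ‖(ball 0 R).indicator g y‖ₑ) y := by
    intro y hy
    by_cases hyx : y ∈ ball x (2 * R * t)
    · rw [indicator_of_mem hyx, indicator_of_mem hy, mul_comm]
      gcongr
      exact hη.le _
    · have : η (x + t⁻¹ • (y - x)) = 0 := by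
        by_contra h
        exact hyx (hη.tsupport_dilation_subset hx ht0 ht1
          (subset_tsupport (fun y => η (x + t⁻¹ • (y - x))) h)).2
      simp [this]
  calc _ ≤ ∫⁻ y in ball 0 R, (ball x (2 * R * t)).indicator
          (fun y => ENNReal.ofReal (t⁻¹ ^ d * (4 ^ d / V.toReal)) *
            ‖(ball 0 R).indicator g y‖ₑ) y := setLIntegral_mono' measurableSet_ball hpt
    _ ≤ ∫⁻ y, (ball x (2 * R * t)).indicator
          (fun y => ENNReal.ofReal (t⁻¹ ^ d * (4 ^ d / V.toReal)) *
            ‖(ball 0 R).indicator g y‖ₑ) y := setLIntegral_le_lintegral _ _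
    _ = ENNReal.ofReal (t⁻¹ ^ d * (4 ^ d / V.toReal)) *
          ∫⁻ y in ball x (2 * R * t), ‖(ball 0 R).indicator g y‖ₑ := by
        rw [lintegral_indicator measurableSet_ball, lintegral_const_mul' _ _ ENNReal.ofReal_ne_top]
    _ = _ := by
        rw [← measure_mul_setLAverage _ measure_ball_lt_top.ne, hvol, ← mul_assoc, ← mul_assoc]
        congr 1
        conv_lhs => rw [← ENNReal.ofReal_toReal hVt]
        rw [ENNReal.toReal_ofReal ENNReal.toReal_nonneg,
          ← ENNReal.ofReal_mul (by positivity), ← ENNReal.ofReal_mul (by positivity)]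
        have hVr' : V.toReal ≠ 0 := hVr.ne'
        -- Here 8 = 4 · 2: the 4 comes from the density bound, the 2 from the radius 2Rt; the powers
        -- of t cancel.
        have : t⁻¹ ^ d * (4 ^ d / V.toReal) * (2 * t) ^ d * V.toReal = 8 ^ d := by
          rw [mul_pow, inv_pow, show (8 : ℝ) = 4 * 2 by norm_num, mul_pow]
          field_simp
        rw [this, ENNReal.ofReal_pow (by norm_num), ENNReal.ofReal_ofNat]

/-- The test field is the contracted density times (y - x)/t, a vector of length below 2R on the
support; Cauchy–Schwarz does the rest. -/
theorem IsBallWeight.enorm_integral_radialTest_le (hη : IsBallWeight R η) (hx : x ∈ ball 0 R)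
    {t : ℝ} (ht0 : 0 < t) (ht1 : t ≤ 1)
    (v : EuclideanSpace ℝ (Fin d) → EuclideanSpace ℝ (Fin d)) :
    ‖∫ y in ball 0 R, ∑ i, v y i * radialTest η x t i y‖ₑ ≤
      ENNReal.ofReal (2 * R) * (8 ^ d * ⨍⁻ y in ball x (2 * R * t), ‖(ball 0 R).indicator v y‖ₑ ∂volume) := by
  have hR : 0 < R := by
    rw [mem_ball_zero_iff] at hx; exact (norm_nonneg x).trans_lt hx
  have hpt : ∀ y, ‖∑ i, v y i * radialTest η x t i y‖ₑ ≤ ENNReal.ofReal (2 * R) *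
      (‖v y‖ₑ * ENNReal.ofReal (t⁻¹ ^ d * η (x + t⁻¹ • (y - x)))) := by
    intro y
    have h1 : ∑ i, v y i * radialTest η x t i y =
        inner ℝ (y - x) (v y) * (t⁻¹ ^ (d + 1) * η (x + t⁻¹ • (y - x))) := by
      simp only [radialTest, PiLp.inner_apply, Finset.sum_mul]
      refine Finset.sum_congr rfl fun i _ => ?_
      simp only [RCLike.inner_apply, conj_trivial]
      ring
    by_cases hyx : y ∈ ball x (2 * R * t)
    · rw [mem_ball, dist_eq_norm] at hyx
      have h0 := hη.nonneg (x + t⁻¹ • (y - x))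
      rw [h1, ← ofReal_norm, ← ofReal_norm, ← ENNReal.ofReal_mul (norm_nonneg _),
        ← ENNReal.ofReal_mul (by positivity)]
      refine ENNReal.ofReal_le_ofReal ?_
      rw [norm_mul, Real.norm_of_nonneg (by positivity : 0 ≤ t⁻¹ ^ (d + 1) * η _)]
      calc _ ≤ (2 * R * t * ‖v y‖) * (t⁻¹ ^ (d + 1) * η (x + t⁻¹ • (y - x))) := by
            gcongr
            exact (norm_inner_le_norm _ _).trans (by gcongr)
        _ = _ := by
            rw [pow_succ]
            field_simp
    · have : η (x + t⁻¹ • (y - x)) = 0 := by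
        by_contra h
        exact hyx (hη.tsupport_dilation_subset hx ht0 ht1
          (subset_tsupport (fun y => η (x + t⁻¹ • (y - x))) h)).2
      simp [h1, this]
  calc _ ≤ ∫⁻ y in ball 0 R, ‖∑ i, v y i * radialTest η x t i y‖ₑ :=
        enorm_integral_le_lintegral_enorm _
    _ ≤ ∫⁻ y in ball 0 R, ENNReal.ofReal (2 * R) *
          (‖v y‖ₑ * ENNReal.ofReal (t⁻¹ ^ d * η (x + t⁻¹ • (y - x)))) := lintegral_mono hpt
    _ ≤ _ := by
        rw [lintegral_const_mul' _ _ ENNReal.ofReal_ne_top]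
        gcongr
        exact hη.lintegral_dilation_le hx ht0 ht1 v

theorem IsBallWeight.integral_dilation (hη : IsBallWeight R η) (hx : x ∈ ball 0 R)
    {t : ℝ} (ht0 : 0 < t) (ht1 : t ≤ 1) :
    ∫ y in ball 0 R, t⁻¹ ^ d * η (x + t⁻¹ • (y - x)) = 1 := by
  rw [setIntegral_eq_integral_of_forall_compl_eq_zero, integral_const_mul,
    integral_sub_right_eq_self (fun y => η (x + t⁻¹ • y)),
    Measure.integral_comp_inv_smul_of_nonneg volume (fun y => η (x + y)) ht0.le,
    integral_add_left_eq_self η x, hη.integral_eq_one, finrank_euclideanSpace_fin]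
  · simp [ht0.ne']
  · intro y hy
    have : η (x + t⁻¹ • (y - x)) = 0 := by
      by_contra h
      exact hy (hη.tsupport_dilation_subset hx ht0 ht1
        (subset_tsupport (fun y => η (x + t⁻¹ • (y - x))) h)).1
    rw [this, mul_zero]

theorem IsBallWeight.integrable_mul_dilation (hη : IsBallWeight R η)
    {u : EuclideanSpace ℝ (Fin d) → ℝ} {Ω : Set (EuclideanSpace ℝ (Fin d))}
    (hu : IntegrableOn u Ω) (x : EuclideanSpace ℝ (Fin d)) (t : ℝ) :
    IntegrableOn (fun y => u y * (t⁻¹ ^ d * η (x + t⁻¹ • (y - x)))) Ω := by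
  have := hη.contDiff.continuous
  obtain ⟨C, hC⟩ := hη.hasCompactSupport.exists_bound_of_continuous this
  refine hu.mul_bdd (c := ‖t⁻¹ ^ d‖ * C) (by fun_prop) (ae_of_all _ fun y => ?_)
  rw [norm_mul]
  gcongr
  exact hC _

/-- The weight has unit mass, so c can be moved under the integral. The choice c = u(x) serves
Lebesgue points, and c = 0 bounds the mean itself. -/
theorem IsBallWeight.enorm_dilationAverage_sub_le (hη : IsBallWeight R η) (hx : x ∈ ball 0 R)
    {u : EuclideanSpace ℝ (Fin d) → ℝ} (hu : IntegrableOn u (ball 0 R)) (c : ℝ)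
    {t : ℝ} (ht0 : 0 < t) (ht1 : t ≤ 1) :
    ‖dilationAverage (ball 0 R) η u x t - c‖ₑ ≤
      8 ^ d * ⨍⁻ y in ball x (2 * R * t), ‖(ball 0 R).indicator (fun y => u y - c) y‖ₑ ∂volume := by
  have h1 : dilationAverage (ball 0 R) η u x t - c =
      ∫ y in ball 0 R, (u y - c) * (t⁻¹ ^ d * η (x + t⁻¹ • (y - x))) := by
    simp_rw [sub_mul]
    rw [integral_sub (hη.integrable_mul_dilation hu x t)
      (hη.integrable_mul_dilation (u := fun _ => c)
        (integrableOn_const measure_ball_lt_top.ne) x t),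
      integral_const_mul, hη.integral_dilation hx ht0 ht1, mul_one]
    rfl
  rw [h1]
  refine (enorm_integral_le_lintegral_enorm _).trans
    (le_trans (le_of_eq ?_) (hη.lintegral_dilation_le hx ht0 ht1 fun y => u y - c))
  refine lintegral_congr fun y => ?_
  have := hη.nonneg (x + t⁻¹ • (y - x))
  rw [enorm_mul, Real.enorm_of_nonneg
    (by positivity : 0 ≤ t⁻¹ ^ d * η (x + t⁻¹ • (y - x)))]

/-- Dilation averages converge to the function at almost every point. -/
theorem IsBallWeight.ae_tendsto_dilationAverage (hR : 0 < R) (hη : IsBallWeight R η)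
    {u : EuclideanSpace ℝ (Fin d) → ℝ} (hu : IntegrableOn u (ball 0 R)) :
    ∀ᵐ x, x ∈ ball (0 : EuclideanSpace ℝ (Fin d)) R →
      Tendsto (dilationAverage (ball 0 R) η u x) (𝓝[>] 0) (𝓝 (u x)) := by
  have hloc : LocallyIntegrable ((ball (0 : EuclideanSpace ℝ (Fin d)) R).indicator u) volume :=
    ((integrable_indicator_iff measurableSet_ball).2 hu).locallyIntegrable
  -- Almost every point is a Lebesgue point, in the L¹ sense, of the extension of u by zero.
  filter_upwards [(IsUnifLocDoublingMeasure.vitaliFamily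
    (volume : Measure (EuclideanSpace ℝ (Fin d))) 1).ae_tendsto_lintegral_enorm_sub_div hloc]
    with x hx hxR
  have hδ : Tendsto (fun t : ℝ => 2 * R * t) (𝓝[>] 0) (𝓝[>] 0) := by
    refine tendsto_nhdsWithin_iff.2 ⟨?_, ?_⟩
    · have : ContinuousAt (fun t : ℝ => 2 * R * t) 0 := by fun_prop
      have h2 := this.tendsto.mono_left (nhdsWithin_le_nhds (s := Ioi (0 : ℝ)))
      simpa using h2
    · filter_upwards [self_mem_nhdsWithin] with t ht
      have : 0 < t := ht
      exact mem_Ioi.2 (by positivity)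
  have hlim := hx.comp (IsUnifLocDoublingMeasure.tendsto_closedBall_filterAt
    (volume : Measure (EuclideanSpace ℝ (Fin d))) (K := 1) (fun _ => x) _ hδ (by
      filter_upwards [self_mem_nhdsWithin] with t ht
      have : 0 < t := ht
      exact mem_closedBall_self (by positivity)))
  have hlim' := ENNReal.Tendsto.const_mul (a := (8 : ℝ≥0∞) ^ d) hlim (Or.inr (by finiteness))
  rw [mul_zero] at hlim'
  rw [tendsto_iff_edist_tendsto_0]
  refine tendsto_of_tendsto_of_tendsto_of_le_of_le' tendsto_const_nhds hlim'
    (Eventually.of_forall fun _ => zero_le) ?_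
  filter_upwards [self_mem_nhdsWithin, nhdsWithin_le_nhds (Iic_mem_nhds one_pos)] with t ht0 ht1
  have ht0 : 0 < t := ht0
  rw [edist_eq_enorm_sub]
  refine (hη.enorm_dilationAverage_sub_le hxR hu (u x) ht0 ht1).trans ?_
  gcongr
  rw [setLAverage_eq, Function.comp_apply, Measure.addHaar_closedBall _ _ (by positivity),
    ← Measure.addHaar_ball_of_pos _ x (by positivity)]
  gcongr ?_ / _
  refine (lintegral_mono fun y => ?_).trans (lintegral_mono_set ball_subset_closedBall)
  by_cases hy : y ∈ ball (0 : EuclideanSpace ℝ (Fin d)) R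
  · simp [hy, hxR]
  · simp [hy]

/-- Integrating a derivative bound that is the better of a constant and a power. -/
theorem abs_sub_le_of_hasDerivAt_of_rpow_bound {A A' : ℝ → ℝ} {C L M K μ δ : ℝ} (hC : 0 ≤ C)
    (hL : 0 < L) (hM : 0 ≤ M) (hK : 0 ≤ K) (hμ : 1 < μ) (hδ : 0 < δ)
    (hA : ∀ t, 0 < t → t ≤ 1 → HasDerivAt A (A' t) t)
    (h1 : ∀ t, 0 < t → t ≤ 1 → |A' t| ≤ L * (C * M))
    (h2 : ∀ t, 0 < t → t ≤ 1 → |A' t| ≤ L * (C * (K * (L * t) ^ (-μ))))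
    {s : ℝ} (hs0 : 0 < s) (hs1 : s ≤ 1) (hsδ : L * s ≤ δ) :
    |A 1 - A s| ≤ C * (M * δ + K * (δ ^ (1 - μ) / (μ - 1))) := by
  have hfirst : ∀ τ, s ≤ τ → τ ≤ 1 → L * τ ≤ δ → |A τ - A s| ≤ C * (M * δ) := by
    intro τ hsτ hτ1 hτ
    have := norm_image_sub_le_of_norm_deriv_right_le_segment (f := A) (f' := A')
      (C := L * (C * M)) (a := s) (b := τ)
      (fun t ht => (hA t (hs0.trans_le ht.1) (ht.2.trans hτ1)).continuousAt.continuousWithinAt)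
      (fun t ht => (hA t (hs0.trans_le ht.1) (ht.2.le.trans hτ1)).hasDerivWithinAt)
      (fun t ht => h1 t (hs0.trans_le ht.1) (ht.2.le.trans hτ1)) τ (right_mem_Icc.2 hsτ)
    refine this.trans ?_
    calc L * (C * M) * (τ - s) ≤ (C * M) * (L * τ) := by
          have : 0 ≤ C * M * L * s := by positivity
          linarith
      _ ≤ C * M * δ := by gcongr
      _ = _ := by ring
  have hnn : 0 ≤ C * (K * (δ ^ (1 - μ) / (μ - 1))) := by
    have : 0 < μ - 1 := by linarith
    positivity
  -- The two bounds are exchanged at Lτ = δ. If δ ≥ L this lies at or beyond t = 1 and the constant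
  -- bound alone suffices.
  rcases le_total δ L with hδL | hδL
  · set τ := δ / L with hτ
    have hτ0 : 0 < τ := by positivity
    have hLτ : L * τ = δ := by rw [hτ]; field_simp
    have hτ1 : τ ≤ 1 := by rw [hτ]; exact (div_le_one hL).2 hδL
    have hsτ : s ≤ τ := by rw [hτ, le_div_iff₀ hL]; linarith
    -- The primitive of the power bound that vanishes at τ; dropping its subtracted term at t = 1
    -- leaves δ^(1-μ)/(μ-1).
    set B : ℝ → ℝ := fun t => C * K * ((δ ^ (1 - μ) - (L * t) ^ (1 - μ)) / (μ - 1)) with hB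
    have hμ1 : μ - 1 ≠ 0 := by linarith
    have hBd : ∀ t, 0 < t → HasDerivAt B (L * (C * (K * (L * t) ^ (-μ)))) t := by
      intro t ht
      have e1 : HasDerivAt (fun t : ℝ => L * t) L t := by
        simpa using (hasDerivAt_id t).const_mul L
      have e2 := (((e1.rpow_const (p := 1 - μ) (Or.inl (by positivity))).const_sub
        (δ ^ (1 - μ))).div_const (μ - 1)).const_mul (C * K)
      refine e2.congr_deriv ?_
      rw [show 1 - μ - 1 = -μ by ring]
      field_simp
      ring
    have hsecond : ‖A 1 - A τ‖ ≤ B 1 := by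
      refine image_norm_le_of_norm_deriv_right_le_deriv_boundary' (f := fun t => A t - A τ)
        (f' := A') (B' := fun t => L * (C * (K * (L * t) ^ (-μ)))) (a := τ) (b := 1) ?_ ?_ ?_ ?_ ?_ ?_
        (right_mem_Icc.2 hτ1)
      · exact fun t ht => ((hA t (hτ0.trans_le ht.1) ht.2).sub_const
          (A τ)).continuousAt.continuousWithinAt
      · exact fun t ht => ((hA t (hτ0.trans_le ht.1) ht.2.le).sub_const (A τ)).hasDerivWithinAt
      · simp [hB, hLτ]
      · exact fun t ht => (hBd t (hτ0.trans_le ht.1)).continuousAt.continuousWithinAt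
      · exact fun t ht => (hBd t (hτ0.trans_le ht.1)).hasDerivWithinAt
      · exact fun t ht => h2 t (hτ0.trans_le ht.1) ht.2.le
    have hB1 : B 1 ≤ C * (K * (δ ^ (1 - μ) / (μ - 1))) := by
      rw [hB, ← mul_assoc]
      have : 0 < μ - 1 := by linarith
      dsimp only
      gcongr
      have : 0 ≤ (L * 1) ^ (1 - μ) := by positivity
      linarith
    calc |A 1 - A s| ≤ |A 1 - A τ| + |A τ - A s| := abs_sub_le _ _ _
      _ ≤ C * (K * (δ ^ (1 - μ) / (μ - 1))) + C * (M * δ) :=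
          add_le_add (hsecond.trans hB1) (hfirst τ hsτ hτ1 hLτ.le)
      _ = _ := by ring
  · have := hfirst 1 hs1 le_rfl (by linarith)
    calc |A 1 - A s| ≤ C * (M * δ) + 0 := by linarith
      _ ≤ C * (M * δ) + C * (K * (δ ^ (1 - μ) / (μ - 1))) := by gcongr
      _ = _ := by ring

end PointwiseEstimate

/-! ### Hedberg's pointwise inequality. -/

section HedbergEstimate

open Filter Topology

variable {d : ℕ} {R : ℝ} {η : EuclideanSpace ℝ (Fin d) → ℝ} {x : EuclideanSpace ℝ (Fin d)}
  {u : EuclideanSpace ℝ (Fin d) → ℝ} {Du : EuclideanSpace ℝ (Fin d) → EuclideanSpace ℝ (Fin d)}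

/-- The one-variable estimate with L = 2R is uniform in the lower endpoint s, so s → 0 replaces the
average by u(x). -/
theorem IsBallWeight.abs_sub_le_of_average_bounds (hd : d ≠ 0) (hη : IsBallWeight R η)
    (hu : IntegrableOn u (ball 0 R)) (hDu : IntegrableOn Du (ball 0 R))
    (hw : HasWeakGradient (ball 0 R) u Du) (hx : x ∈ ball 0 R)
    (hlim : Tendsto (dilationAverage (ball 0 R) η u x) (𝓝[>] 0) (𝓝 (u x)))
    {M K μ δ : ℝ} (hM0 : 0 ≤ M) (hK0 : 0 ≤ K) (hμ : 1 < μ) (hδ : 0 < δ)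
    (hM : ∀ r, 0 < r → ⨍⁻ y in ball x r, ‖(ball 0 R).indicator Du y‖ₑ ∂volume ≤ ENNReal.ofReal M)
    (hK : ∀ r, 0 < r → ⨍⁻ y in ball x r, ‖(ball 0 R).indicator Du y‖ₑ ∂volume ≤
      ENNReal.ofReal (K * r ^ (-μ))) :
    |dilationAverage (ball 0 R) η u x 1 - u x| ≤
      8 ^ d * (M * δ + K * (δ ^ (1 - μ) / (μ - 1))) := by
  have hR : 0 < R := by
    rw [mem_ball_zero_iff] at hx; exact (norm_nonneg x).trans_lt hx
  have hbound : ∀ t, 0 < t → t ≤ 1 → ∀ m : ℝ, 0 ≤ m →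
      ⨍⁻ y in ball x (2 * R * t), ‖(ball 0 R).indicator Du y‖ₑ ∂volume ≤ ENNReal.ofReal m →
      |∫ y in ball 0 R, ∑ i, Du y i * radialTest η x t i y| ≤ 2 * R * (8 ^ d * m) := by
    intro t ht0 ht1 m hm h
    have h1 : ‖∫ y in ball 0 R, ∑ i, Du y i * radialTest η x t i y‖ₑ ≤
        ENNReal.ofReal (2 * R) * (8 ^ d * ENNReal.ofReal m) :=
      (hη.enorm_integral_radialTest_le hx ht0 ht1 Du).trans (by gcongr)
    have h8 : (8 : ℝ≥0∞) ^ d = ENNReal.ofReal (8 ^ d) := by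
      rw [ENNReal.ofReal_pow (by norm_num), ENNReal.ofReal_ofNat]
    rw [h8, ← ENNReal.ofReal_mul (by positivity), ← ENNReal.ofReal_mul (by positivity),
      ← ofReal_norm, ENNReal.ofReal_le_ofReal_iff (by positivity)] at h1
    exact h1
  have hlim' : Tendsto (fun s => |dilationAverage (ball 0 R) η u x 1 -
      dilationAverage (ball 0 R) η u x s|) (𝓝[>] 0)
      (𝓝 |dilationAverage (ball 0 R) η u x 1 - u x|) := (hlim.const_sub _).abs
  refine le_of_tendsto hlim' ?_
  filter_upwards [self_mem_nhdsWithin, nhdsWithin_le_nhds (Iic_mem_nhds one_pos),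
    nhdsWithin_le_nhds (Iic_mem_nhds (by positivity : 0 < δ / (2 * R)))] with s hs0 hs1 hsδ
  refine abs_sub_le_of_hasDerivAt_of_rpow_bound (L := 2 * R) (by positivity) (by positivity)
    hM0 hK0 hμ hδ (fun t ht0 ht1 => hasDerivAt_dilationAverage hd hu hDu hw hη.contDiff
      hη.hasCompactSupport x ht0
      ((hη.tsupport_dilation_subset hx ht0 ht1).trans inter_subset_left))
    (fun t ht0 ht1 => hbound t ht0 ht1 M hM0 (hM _ (by positivity)))
    (fun t ht0 ht1 => hbound t ht0 ht1 _ (by positivity) (hK _ (by positivity))) hs0 hs1 ?_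
  have : s ≤ δ / (2 * R) := hsδ
  rw [le_div_iff₀ (by positivity)] at this
  linarith

/-- Hedberg's inequality for dilation averages. -/
theorem IsBallWeight.enorm_sub_rpow_le (hd : d ≠ 0) (hη : IsBallWeight R η)
    (hu : IntegrableOn u (ball 0 R)) (hDu : IntegrableOn Du (ball 0 R))
    (hw : HasWeakGradient (ball 0 R) u Du) (hx : x ∈ ball 0 R)
    (hlim : Tendsto (dilationAverage (ball 0 R) η u x) (𝓝[>] 0) (𝓝 (u x)))
    {M : ℝ≥0∞} {K μ s : ℝ} (hM0 : M ≠ 0) (hK0 : 0 < K) (hμ : 1 < μ) (hs : 0 < s)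
    (hM : ∀ r, 0 < r → ⨍⁻ y in ball x r, ‖(ball 0 R).indicator Du y‖ₑ ∂volume ≤ M)
    (hK : ∀ r, 0 < r → ⨍⁻ y in ball x r, ‖(ball 0 R).indicator Du y‖ₑ ∂volume ≤
      ENNReal.ofReal (K * r ^ (-μ))) :
    ‖u x - dilationAverage (ball 0 R) η u x 1‖ₑ ^ s ≤
      ENNReal.ofReal ((8 ^ d * (μ / (μ - 1))) ^ s * K ^ (s / μ)) * M ^ (s - s / μ) := by
  have hμ0 : 0 < μ := by linarith
  have hμ1 : 0 < μ - 1 := by linarith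
  have hexp : 0 < s - s / μ := by
    rw [sub_pos]; exact div_lt_self hs hμ
  rcases eq_or_ne M ⊤ with rfl | hMt
  · rw [ENNReal.top_rpow_of_pos hexp, ENNReal.mul_top]
    · exact le_top
    · have : 0 < (8 ^ d * (μ / (μ - 1))) ^ s * K ^ (s / μ) := by positivity
      simpa using this
  lift M to ℝ≥0 using hMt
  have hMpos : 0 < (M : ℝ) := by
    have : M ≠ 0 := by simpa using hM0
    exact_mod_cast pos_iff_ne_zero.2 this
  -- This δ solves Mδ = Kδ^(1-μ), balancing the two terms; their sum carries the factor 1 + 1/(μ-1)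
  -- = μ/(μ-1).
  have hδ : 0 < (K / M) ^ (1 / μ) := by positivity
  have h1 := hη.abs_sub_le_of_average_bounds hd hu hDu hw hx hlim hMpos.le hK0.le hμ hδ
    (by simpa only [ENNReal.ofReal_coe_nnreal] using hM) hK
  have e1 : (M : ℝ) * (K / M) ^ (1 / μ) = M ^ (1 - 1 / μ) * K ^ (1 / μ) := by
    rw [Real.div_rpow hK0.le hMpos.le, Real.rpow_sub hMpos, Real.rpow_one]
    field_simp
  have e2 : K * ((K / M) ^ (1 / μ)) ^ (1 - μ) = M ^ (1 - 1 / μ) * K ^ (1 / μ) := by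
    rw [← Real.rpow_mul (by positivity), show 1 / μ * (1 - μ) = 1 / μ - 1 by field_simp,
      Real.div_rpow hK0.le hMpos.le, Real.rpow_sub_one hK0.ne',
      show 1 - 1 / μ = -(1 / μ - 1) by ring, Real.rpow_neg hMpos.le]
    field_simp
  have h2 : |dilationAverage (ball 0 R) η u x 1 - u x| ≤
      8 ^ d * (μ / (μ - 1)) * (M ^ (1 - 1 / μ) * K ^ (1 / μ)) := by
    refine h1.trans (le_of_eq ?_)
    rw [← mul_div_assoc, e1, e2]
    field_simp
    ring
  have h3 : |dilationAverage (ball 0 R) η u x 1 - u x| ^ s ≤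
      (8 ^ d * (μ / (μ - 1))) ^ s * K ^ (s / μ) * M ^ (s - s / μ) := by
    refine (Real.rpow_le_rpow (abs_nonneg _) h2 hs.le).trans (le_of_eq ?_)
    rw [Real.mul_rpow (by positivity) (by positivity),
      Real.mul_rpow (x := (M : ℝ) ^ (1 - 1 / μ)) (by positivity) (by positivity),
      ← Real.rpow_mul hMpos.le,
      ← Real.rpow_mul hK0.le, show (1 - 1 / μ) * s = s - s / μ by ring,
      show 1 / μ * s = s / μ by ring]
    ring
  rw [← ENNReal.ofReal_coe_nnreal, ENNReal.ofReal_rpow_of_pos hMpos,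
    ← ENNReal.ofReal_mul (by positivity), ← ofReal_norm,
    ENNReal.ofReal_rpow_of_nonneg (norm_nonneg _) hs.le, Real.norm_eq_abs, abs_sub_comm]
  exact ENNReal.ofReal_le_ofReal h3

end HedbergEstimate

/-! ### Averages as norms over probability measures. -/

section MorreyNorm

variable {d : ℕ} {F : Type*} [NormedAddCommGroup F]

/-- The normalized Lebesgue measure on a ball. -/
noncomputable def ballMeasure (x : EuclideanSpace ℝ (Fin d)) (ρ : ℝ) :
    Measure (EuclideanSpace ℝ (Fin d)) :=
  (volume.restrict (ball x ρ) univ)⁻¹ • volume.restrict (ball x ρ)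

theorem isProbabilityMeasure_ballMeasure (x : EuclideanSpace ℝ (Fin d)) {ρ : ℝ} (hρ : 0 < ρ) :
    IsProbabilityMeasure (ballMeasure x ρ) := by
  refine ⟨?_⟩
  rw [ballMeasure, Measure.smul_apply, smul_eq_mul, Measure.restrict_apply_univ]
  exact ENNReal.inv_mul_cancel (measure_ball_pos _ _ hρ).ne' measure_ball_lt_top.ne

/-- `ballMeasure` is spelled as the average unfolds, hence `rfl`; Jensen and Minkowski then come
from `eLpNorm'`. -/
theorem avgLpNorm_eq_eLpNorm' (p : ℝ) (Ω : Set (EuclideanSpace ℝ (Fin d)))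
    (g : EuclideanSpace ℝ (Fin d) → F) (x : EuclideanSpace ℝ (Fin d)) (ρ : ℝ) :
    avgLpNorm p Ω g x ρ = eLpNorm' (Ω.indicator g) p (ballMeasure x ρ) := rfl

theorem _root_.MeasureTheory.AEStronglyMeasurable.ballMeasure
    {g : EuclideanSpace ℝ (Fin d) → F} (hg : AEStronglyMeasurable g volume)
    (x : EuclideanSpace ℝ (Fin d)) (ρ : ℝ) : AEStronglyMeasurable g (ballMeasure x ρ) :=
  (hg.restrict (s := ball x ρ)).smul_measure _

theorem avgLpNorm_mono_exponent {p q : ℝ} (hp : 0 < p) (hpq : p ≤ q)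
    {Ω : Set (EuclideanSpace ℝ (Fin d))} (hΩ : MeasurableSet Ω)
    {g : EuclideanSpace ℝ (Fin d) → F} (hg : AEStronglyMeasurable g (volume.restrict Ω))
    (x : EuclideanSpace ℝ (Fin d)) {ρ : ℝ} (hρ : 0 < ρ) :
    avgLpNorm p Ω g x ρ ≤ avgLpNorm q Ω g x ρ := by
  have := isProbabilityMeasure_ballMeasure x hρ
  rw [avgLpNorm_eq_eLpNorm', avgLpNorm_eq_eLpNorm']
  exact eLpNorm'_le_eLpNorm'_of_exponent_le hp hpq _
    (((aestronglyMeasurable_indicator_iff hΩ).2 hg).ballMeasure x ρ)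

theorem morreyNorm_mono_exponent {p q : ℝ} (hp : 0 < p) (hpq : p ≤ q) (μ : ℝ)
    {Ω : Set (EuclideanSpace ℝ (Fin d))} (hΩ : MeasurableSet Ω)
    {g : EuclideanSpace ℝ (Fin d) → F} (hg : AEStronglyMeasurable g (volume.restrict Ω)) :
    morreyNorm p μ Ω g ≤ morreyNorm q μ Ω g := by
  unfold morreyNorm
  gcongr with ρ hρ x hx
  exact avgLpNorm_mono_exponent hp hpq hΩ hg x hρ

theorem avgLpNorm_le_of_morreyNorm_le {p μ K : ℝ} {Ω : Set (EuclideanSpace ℝ (Fin d))}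
    {g : EuclideanSpace ℝ (Fin d) → F} {x : EuclideanSpace ℝ (Fin d)} (hx : x ∈ Ω) {ρ : ℝ}
    (hρ : 0 < ρ) (hK : morreyNorm p μ Ω g ≤ ENNReal.ofReal K) :
    avgLpNorm p Ω g x ρ ≤ ENNReal.ofReal (K * ρ ^ (-μ)) := by
  have h1 : ENNReal.ofReal (ρ ^ μ) * avgLpNorm p Ω g x ρ ≤ ENNReal.ofReal K :=
    
    le_trans (le_iSup₂_of_le ρ hρ (le_iSup₂ (f := fun x (_ : x ∈ Ω) =>
      ENNReal.ofReal (ρ ^ μ) * avgLpNorm p Ω g x ρ) x hx)) hK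
  have h2 : 0 < ρ ^ μ := by positivity
  rw [Real.rpow_neg hρ.le, ← div_eq_mul_inv, ENNReal.ofReal_div_of_pos h2,
    ENNReal.le_div_iff_mul_le (Or.inl (by simpa using h2)) (Or.inl ENNReal.ofReal_ne_top), mul_comm]
  exact h1

theorem avgLpNorm_rpow {p : ℝ} (hp : p ≠ 0) (Ω : Set (EuclideanSpace ℝ (Fin d)))
    (g : EuclideanSpace ℝ (Fin d) → F) (x : EuclideanSpace ℝ (Fin d)) (ρ : ℝ) :
    avgLpNorm p Ω g x ρ ^ p = ⨍⁻ y in ball x ρ, ‖Ω.indicator g y‖ₑ ^ p ∂volume := by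
  rw [avgLpNorm, ← ENNReal.rpow_mul, one_div_mul_cancel hp, ENNReal.rpow_one]

theorem avgLpNorm_one (Ω : Set (EuclideanSpace ℝ (Fin d)))
    (g : EuclideanSpace ℝ (Fin d) → F) (x : EuclideanSpace ℝ (Fin d)) (ρ : ℝ) :
    avgLpNorm 1 Ω g x ρ = ⨍⁻ y in ball x ρ, ‖Ω.indicator g y‖ₑ ∂volume := by
  simp [avgLpNorm]

end MorreyNorm

/-! ### Morrey bounds for constants and for the oscillation. -/

section MorreyBounds

open Filter Topology

variable {d : ℕ} {F : Type*} [NormedAddCommGroup F]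

theorem morreyNorm_add_le {p μ : ℝ} (hp : 1 ≤ p) {Ω : Set (EuclideanSpace ℝ (Fin d))}
    (hΩ : MeasurableSet Ω) {f g : EuclideanSpace ℝ (Fin d) → F}
    (hf : AEStronglyMeasurable f (volume.restrict Ω))
    (hg : AEStronglyMeasurable g (volume.restrict Ω)) :
    morreyNorm p μ Ω (f + g) ≤ morreyNorm p μ Ω f + morreyNorm p μ Ω g := by
  refine iSup₂_le fun ρ hρ => iSup₂_le fun x hx => ?_
  have hle : ∀ h : EuclideanSpace ℝ (Fin d) → F,
      ENNReal.ofReal (ρ ^ μ) * avgLpNorm p Ω h x ρ ≤ morreyNorm p μ Ω h := fun h =>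
    le_iSup₂_of_le ρ hρ (le_iSup₂ (f := fun x (_ : x ∈ Ω) =>
      ENNReal.ofReal (ρ ^ μ) * avgLpNorm p Ω h x ρ) x hx)
  refine le_trans ?_ (add_le_add (hle f) (hle g))
  rw [← mul_add]
  gcongr
  simp only [avgLpNorm_eq_eLpNorm', indicator_add']
  exact eLpNorm'_add_le (((aestronglyMeasurable_indicator_iff hΩ).2 hf).ballMeasure x ρ)
    (((aestronglyMeasurable_indicator_iff hΩ).2 hg).ballMeasure x ρ) hp

/-- For ρ ≥ R the domain fills at most the fraction (R/ρ)^d of the ball, and νs ≤ d turns this into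
(R/ρ)^(νs), offsetting the growth of ρ^ν. -/
theorem morreyNorm_const_ball_le {R s ν : ℝ} (hR : 0 < R) (hs : 0 < s) (hν : 0 ≤ ν)
    (hνs : ν * s ≤ d) (c : F) :
    morreyNorm s ν (ball (0 : EuclideanSpace ℝ (Fin d)) R) (fun _ => c) ≤
      ENNReal.ofReal (R ^ ν) * ‖c‖ₑ := by
  refine iSup₂_le fun ρ hρ => iSup₂_le fun x hx => ?_
  have hpow : ∀ y, ‖(ball (0 : EuclideanSpace ℝ (Fin d)) R).indicator (fun _ => c) y‖ₑ ^ s =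
      (ball (0 : EuclideanSpace ℝ (Fin d)) R).indicator (fun _ => ‖c‖ₑ ^ s) y := by
    intro y
    by_cases hy : y ∈ ball (0 : EuclideanSpace ℝ (Fin d)) R
    · simp [indicator_of_mem hy]
    · simp [indicator_of_notMem hy, hs]
  have havg : avgLpNorm s (ball (0 : EuclideanSpace ℝ (Fin d)) R) (fun _ => c) x ρ ^ s =
      ‖c‖ₑ ^ s * volume (ball 0 R ∩ ball x ρ) / volume (ball x ρ) := by
    rw [avgLpNorm_rpow hs.ne', setLAverage_eq]
    simp_rw [hpow]
    rw [lintegral_indicator_const measurableSet_ball, Measure.restrict_apply measurableSet_ball]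
  rcases le_total ρ R with h | h
  · gcongr
    refine (ENNReal.rpow_le_rpow_iff hs).1 ?_
    rw [havg]
    refine ENNReal.div_le_of_le_mul ?_
    gcongr
    exact inter_subset_right
  · have h1 : avgLpNorm s (ball (0 : EuclideanSpace ℝ (Fin d)) R) (fun _ => c) x ρ ≤
        ENNReal.ofReal ((R / ρ) ^ ν) * ‖c‖ₑ := by
      refine (ENNReal.rpow_le_rpow_iff hs).1 ?_
      rw [havg, ENNReal.mul_rpow_of_nonneg _ _ hs.le,
        ENNReal.ofReal_rpow_of_nonneg (by positivity) hs.le, ← Real.rpow_mul (by positivity)]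
      refine ENNReal.div_le_of_le_mul ?_
      rw [mul_comm (ENNReal.ofReal _), mul_assoc]
      gcongr
      calc volume (ball 0 R ∩ ball x ρ) ≤ volume (ball (0 : EuclideanSpace ℝ (Fin d)) R) :=
            measure_mono inter_subset_left
        _ = ENNReal.ofReal ((R / ρ) ^ d) * volume (ball x ρ) := by
            conv_lhs => rw [show R = (R / ρ) * ρ by field_simp]
            rw [Measure.addHaar_ball_mul_of_pos _ _ (by positivity), finrank_euclideanSpace_fin,
              Measure.addHaar_ball_center _ x]
        _ ≤ _ := by
            gcongr
            rw [← Real.rpow_natCast]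
            exact Real.rpow_le_rpow_of_exponent_ge (by positivity) ((div_le_one hρ).2 h) hνs
    calc _ ≤ ENNReal.ofReal (ρ ^ ν) * (ENNReal.ofReal ((R / ρ) ^ ν) * ‖c‖ₑ) := by gcongr
      _ = _ := by
        rw [← mul_assoc, ← ENNReal.ofReal_mul (by positivity), ← Real.mul_rpow hρ.le
          (by positivity), mul_div_cancel₀ _ hρ.ne']

/-- The single choice x = 0, ρ = R already sees the whole domain. -/
theorem memLp_of_morreyNorm_lt_top {R p μ : ℝ} (hR : 0 < R) (hp : 0 < p)
    {g : EuclideanSpace ℝ (Fin d) → F}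
    (hg : AEStronglyMeasurable g (volume.restrict (ball 0 R)))
    (h : morreyNorm p μ (ball 0 R) g < ⊤) :
    MemLp g (ENNReal.ofReal p) (volume.restrict (ball 0 R)) := by
  refine ⟨hg, ?_⟩
  have h1 := avgLpNorm_le_of_morreyNorm_le (mem_ball_self hR) hR
    (ENNReal.ofReal_toReal h.ne).ge
  have h2 : avgLpNorm p (ball 0 R) g 0 R ^ p < ⊤ :=
    ENNReal.rpow_lt_top_of_nonneg hp.le (h1.trans_lt ENNReal.ofReal_lt_top).ne
  rw [avgLpNorm_rpow hp.ne'] at h2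
  have h3 : ∫⁻ y in ball 0 R, ‖g y‖ₑ ^ p < ⊤ := by
    have h4 : ∫⁻ y in ball 0 R, ‖g y‖ₑ ^ p =
        ∫⁻ y in ball 0 R, ‖(ball 0 R).indicator g y‖ₑ ^ p :=
      setLIntegral_congr_fun measurableSet_ball fun y hy => by rw [indicator_of_mem hy]
    rw [h4, ← measure_mul_setLAverage _ measure_ball_lt_top.ne]
    exact ENNReal.mul_lt_top measure_ball_lt_top h2
  rw [eLpNorm_lt_top_iff_lintegral_rpow_enorm_lt_top (by simpa using hp) ENNReal.ofReal_ne_top,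
    ENNReal.toReal_ofReal hp.le]
  exact h3

/-- The mean `p`-th power of a majorant built from the maximal function of a localized function. -/
theorem setLAverage_hlMaximal_add_rpow_le {p : ℝ} (hp : 1 < p)
    {f : EuclideanSpace ℝ (Fin d) → ℝ≥0∞} (hf : Measurable f) (x₀ : EuclideanSpace ℝ (Fin d))
    {ρ : ℝ} {κ : ℝ≥0∞}
    (hκ : ⨍⁻ y in ball x₀ (2 * ρ), f y ^ p ∂volume ≤ κ ^ p) :
    ⨍⁻ x in ball x₀ ρ, (hlMaximal volume ((ball x₀ (2 * ρ)).indicator f) x + κ) ^ p ∂volume ≤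
      2 ^ (p - 1) * (ENNReal.ofReal p * (2 * 4 ^ d) * (2 ^ (p - 1) / ENNReal.ofReal (p - 1)) *
        2 ^ d + 1) * κ ^ p := by
  set C := ENNReal.ofReal p * (2 * 4 ^ d) * (2 ^ (p - 1) / ENNReal.ofReal (p - 1)) with hC
  set g := (ball x₀ (2 * ρ)).indicator f with hg
  have hgm : Measurable g := hf.indicator measurableSet_ball
  have hstrong := lintegral_hlMaximal_rpow_le (volume : Measure (EuclideanSpace ℝ (Fin d))) hp hgm
  rw [finrank_euclideanSpace_fin, ← hC] at hstrong
  have hp0 : 0 < p := by linarith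
  have hgp : ∫⁻ x, g x ^ p ≤ 2 ^ d * volume (ball x₀ ρ) * κ ^ p := by
    have h1 : ∀ x, g x ^ p = (ball x₀ (2 * ρ)).indicator (fun y => f y ^ p) x := by
      intro x
      by_cases hx : x ∈ ball x₀ (2 * ρ)
      · simp [hg, hx]
      · simp only [hg, indicator_of_notMem hx, ENNReal.zero_rpow_of_pos hp0]
    simp_rw [h1]
    rw [lintegral_indicator measurableSet_ball,
      ← measure_mul_setLAverage _ measure_ball_lt_top.ne,
      Measure.addHaar_ball_mul_of_pos _ _ two_pos, finrank_euclideanSpace_fin,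
      Measure.addHaar_ball_center _ x₀, ENNReal.ofReal_pow two_pos.le, ENNReal.ofReal_ofNat]
    gcongr
  rw [setLAverage_eq]
  refine ENNReal.div_le_of_le_mul ?_
  calc ∫⁻ x in ball x₀ ρ, (hlMaximal volume g x + κ) ^ p
      ≤ ∫⁻ x in ball x₀ ρ, 2 ^ (p - 1) * (hlMaximal volume g x ^ p + κ ^ p) :=
        lintegral_mono fun x => ENNReal.rpow_add_le_mul_rpow_add_rpow _ _ hp.le
    _ = 2 ^ (p - 1) * ((∫⁻ x in ball x₀ ρ, hlMaximal volume g x ^ p) +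
          κ ^ p * volume (ball x₀ ρ)) := by
        rw [lintegral_const_mul' _ _ (ENNReal.rpow_ne_top_of_nonneg (by linarith) (by simp)),
          lintegral_add_right _ measurable_const, setLIntegral_const]
    _ ≤ 2 ^ (p - 1) * (C * (2 ^ d * volume (ball x₀ ρ) * κ ^ p) +
          κ ^ p * volume (ball x₀ ρ)) := by
        gcongr
        exact (setLIntegral_le_lintegral _ _).trans (hstrong.trans (by gcongr))
    _ = _ := by ring

/-- The constant in the local form of Adams' embedding. -/
noncomputable def adamsConst (d : ℕ) (p μ s : ℝ) : ℝ≥0∞ :=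
  (ENNReal.ofReal ((8 ^ d * (μ / (μ - 1))) ^ s) *
    (2 ^ (p - 1) * (ENNReal.ofReal p * (2 * 4 ^ d) * (2 ^ (p - 1) / ENNReal.ofReal (p - 1)) *
      2 ^ d + 1))) ^ (1 / s)

theorem adamsConst_ne_top (d : ℕ) {p μ s : ℝ} (hp : 1 < p) (hs : 0 < s) :
    adamsConst d p μ s ≠ ⊤ := by
  have h1 : (2 : ℝ≥0∞) ^ (p - 1) ≠ ⊤ := ENNReal.rpow_ne_top_of_nonneg (by linarith) (by simp)
  have h2 : (2 : ℝ≥0∞) ^ (p - 1) / ENNReal.ofReal (p - 1) ≠ ⊤ :=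
    (ENNReal.div_lt_top h1 (by simpa using hp)).ne
  refine ENNReal.rpow_ne_top_of_nonneg (by positivity) ?_
  finiteness

variable {R : ℝ} {η : EuclideanSpace ℝ (Fin d) → ℝ}
  {u : EuclideanSpace ℝ (Fin d) → ℝ} {Du : EuclideanSpace ℝ (Fin d) → EuclideanSpace ℝ (Fin d)}

/-- Hedberg's inequality raised to the power s has M^p on the right, so averaging it reduces to the
strong (p, p) bound. -/
theorem IsBallWeight.avgLpNorm_sub_le (hd : d ≠ 0) (hR : 0 < R) (hη : IsBallWeight R η)
    (hu : IntegrableOn u (ball 0 R)) (hDu : IntegrableOn Du (ball 0 R))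
    (hw : HasWeakGradient (ball 0 R) u Du) {p μ s K : ℝ} (hp : 1 < p) (hμ : 1 < μ) (hs : 0 < s)
    (hps : s - s / μ = p) (hK0 : 0 < K)
    (hK : morreyNorm p μ (ball 0 R) Du ≤ ENNReal.ofReal K)
    {x₀ : EuclideanSpace ℝ (Fin d)} (hx₀ : x₀ ∈ ball 0 R) {ρ : ℝ} (hρ : 0 < ρ) :
    avgLpNorm s (ball 0 R) (fun y => u y - ∫ z in ball 0 R, u z * η z) x₀ ρ ≤
      adamsConst d p μ s * ENNReal.ofReal (K * ρ ^ (-(μ - 1))) := by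
  set c := ∫ z in ball 0 R, u z * η z with hc
  have hp0 : 0 < p := by linarith
  have hdil : ∀ x, dilationAverage (ball 0 R) η u x 1 = c := fun x => by
    simp [dilationAverage, hc]
  set f : EuclideanSpace ℝ (Fin d) → ℝ≥0∞ := fun y => ‖(ball 0 R).indicator Du y‖ₑ with hf
  have hDum : AEStronglyMeasurable ((ball 0 R).indicator Du) volume :=
    (aestronglyMeasurable_indicator_iff measurableSet_ball).2 hDu.aestronglyMeasurable
  have hfm : AEMeasurable f volume := hDum.enorm
  -- The strong bound needs a Borel function, while Du is only almost everywhere measurable.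
  set g := hfm.mk f with hg
  have hfg : f =ᵐ[volume] g := hfm.ae_eq_mk
  have hK1 : ∀ x ∈ ball (0 : EuclideanSpace ℝ (Fin d)) R, ∀ r, 0 < r →
      ⨍⁻ y in ball x r, f y ∂volume ≤ ENNReal.ofReal (K * r ^ (-μ)) := by
    intro x hx r hr
    rw [← avgLpNorm_one]
    exact (avgLpNorm_mono_exponent one_pos hp.le measurableSet_ball hDu.aestronglyMeasurable x
      hr).trans (avgLpNorm_le_of_morreyNorm_le hx hr hK)
  -- Since r^(-μ) decreases, the Morrey bound at radius ρ also covers radius 2ρ and every r ≥ ρ.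
  set κ := ENNReal.ofReal (K * ρ ^ (-μ)) with hκ
  have hκ0 : κ ≠ 0 := by
    have : 0 < K * ρ ^ (-μ) := by positivity
    simpa [hκ] using this
  have hgκ : ⨍⁻ y in ball x₀ (2 * ρ), g y ^ p ∂volume ≤ κ ^ p := by
    have h1 : ⨍⁻ y in ball x₀ (2 * ρ), g y ^ p ∂volume =
        ⨍⁻ y in ball x₀ (2 * ρ), f y ^ p ∂volume :=
      laverage_congr (ae_restrict_of_ae (hfg.mono fun y hy => by simp only [hy]))
    rw [h1, ← avgLpNorm_rpow hp0.ne']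
    gcongr
    refine (avgLpNorm_le_of_morreyNorm_le hx₀ (by positivity) hK).trans ?_
    refine ENNReal.ofReal_le_ofReal ?_
    gcongr K * ?_
    exact Real.rpow_le_rpow_of_nonpos hρ (by linarith) (by linarith)
  -- For x in the ball of radius ρ about x₀, radii r < ρ only see the ball of radius 2ρ, so the
  -- localized maximal function suffices there; κ handles larger radii and keeps M nonzero.
  set M : EuclideanSpace ℝ (Fin d) → ℝ≥0∞ := fun x =>
    hlMaximal volume ((ball x₀ (2 * ρ)).indicator g) x + κ with hM
  have hMbound : ∀ x ∈ ball (0 : EuclideanSpace ℝ (Fin d)) R, x ∈ ball x₀ ρ → ∀ r, 0 < r →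
      ⨍⁻ y in ball x r, f y ∂volume ≤ M x := by
    intro x hxR hx r hr
    rcases lt_or_ge r ρ with hrρ | hrρ
    · refine le_trans (le_trans (le_of_eq ?_) (laverage_le_hlMaximal volume _ x hr)) le_self_add
      refine setLAverage_congr_fun_ae measurableSet_ball (hfg.mono fun y hy hyx => ?_)
      rw [indicator_of_mem, hy]
      rw [mem_ball] at hx hyx ⊢
      linarith [dist_triangle y x x₀]
    · refine (hK1 x hxR r hr).trans (le_trans ?_ le_add_self)
      refine ENNReal.ofReal_le_ofReal ?_
      gcongr K * ?_
      exact Real.rpow_le_rpow_of_nonpos hρ hrρ (by linarith)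
  have hmain : ⨍⁻ y in ball x₀ ρ, ‖(ball 0 R).indicator (fun y => u y - c) y‖ₑ ^ s ∂volume ≤
      ENNReal.ofReal ((8 ^ d * (μ / (μ - 1))) ^ s * K ^ (s / μ)) *
        ⨍⁻ x in ball x₀ ρ, M x ^ p ∂volume := by
    rw [setLAverage_eq, setLAverage_eq, ← mul_div_assoc,
      ← lintegral_const_mul' _ _ ENNReal.ofReal_ne_top]
    gcongr ?_ / _
    refine setLIntegral_mono_ae' measurableSet_ball ?_
    filter_upwards [hη.ae_tendsto_dilationAverage hR hu] with x hlim hx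
    by_cases hxR : x ∈ ball (0 : EuclideanSpace ℝ (Fin d)) R
    · have := hη.enorm_sub_rpow_le hd hu hDu hw hxR (hlim hxR) (M := M x) (s := s)
        (fun h => hκ0 (add_eq_zero.1 h).2) hK0 hμ hs (hMbound x hxR hx) (hK1 x hxR)
      rw [hdil, hps] at this
      rw [indicator_of_mem hxR]
      exact this
    · rw [indicator_of_notMem hxR, enorm_zero, ENNReal.zero_rpow_of_pos hs]
      exact zero_le
  have hmax := setLAverage_hlMaximal_add_rpow_le hp hfm.measurable_mk x₀ hgκ
  rw [avgLpNorm]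
  have hs' : 0 ≤ 1 / s := by positivity
  have hμ0 : 0 < μ := by linarith
  calc _ ≤ (ENNReal.ofReal ((8 ^ d * (μ / (μ - 1))) ^ s * K ^ (s / μ)) *
        (2 ^ (p - 1) * (ENNReal.ofReal p * (2 * 4 ^ d) * (2 ^ (p - 1) / ENNReal.ofReal (p - 1)) *
        2 ^ d + 1) * κ ^ p)) ^ (1 / s) := by
        gcongr
        exact hmain.trans (by gcongr)
    _ = (ENNReal.ofReal ((8 ^ d * (μ / (μ - 1))) ^ s) *
        (2 ^ (p - 1) * (ENNReal.ofReal p * (2 * 4 ^ d) * (2 ^ (p - 1) / ENNReal.ofReal (p - 1)) *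
        2 ^ d + 1)) * (ENNReal.ofReal (K ^ (s / μ)) * κ ^ p)) ^ (1 / s) := by
        have : 0 < μ - 1 := by linarith
        rw [ENNReal.ofReal_mul (by positivity)]
        congr 1
        ring
    _ = adamsConst d p μ s * (ENNReal.ofReal (K ^ (s / μ)) * κ ^ p) ^ (1 / s) := by
        rw [ENNReal.mul_rpow_of_nonneg _ _ hs', adamsConst]
    _ = _ := by
        congr 1
        rw [hκ, ENNReal.ofReal_rpow_of_nonneg (by positivity) hp0.le,
          ← ENNReal.ofReal_mul (by positivity), ENNReal.ofReal_rpow_of_nonneg (by positivity) hs']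
        congr 1
        -- Exponent count: s/μ + p = s leaves K to the first power, and μp/s = μ - 1 is the decay in
        -- ρ.
        rw [Real.mul_rpow hK0.le (by positivity), ← Real.rpow_mul hρ.le, ← mul_assoc,
          ← Real.rpow_add hK0, Real.mul_rpow (by positivity) (by positivity),
          ← Real.rpow_mul hK0.le, ← Real.rpow_mul hρ.le, ← hps]
        congr 2
        · rw [show (s / μ + (s - s / μ)) * (1 / s) = 1 by field_simp; ring, Real.rpow_one]
        · field_simp

/-- The weighted mean is the dilation average at x = 0, t = 1, hence at most 8^d times a mean over
radius 2R; Jensen and R^μ ≤ (2R)^μ finish. -/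
theorem IsBallWeight.enorm_integral_mul_le (hR : 0 < R) (hη : IsBallWeight R η)
    (hu : IntegrableOn u (ball 0 R)) {p μ : ℝ} (hp : 1 ≤ p) (hμ : 0 ≤ μ) :
    ENNReal.ofReal (R ^ μ) * ‖∫ z in ball 0 R, u z * η z‖ₑ ≤
      8 ^ d * morreyNorm p μ (ball 0 R) u := by
  have h0 : (0 : EuclideanSpace ℝ (Fin d)) ∈ ball (0 : EuclideanSpace ℝ (Fin d)) R :=
    mem_ball_self hR
  have h1 := hη.enorm_dilationAverage_sub_le h0 hu 0 one_pos le_rfl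
  have h2 : dilationAverage (ball 0 R) η u 0 1 = ∫ z in ball 0 R, u z * η z := by
    simp [dilationAverage]
  simp only [sub_zero, mul_one] at h1
  rw [h2] at h1
  have h3 : ⨍⁻ y in ball 0 (2 * R), ‖(ball 0 R).indicator u y‖ₑ ∂volume ≤
      avgLpNorm p (ball 0 R) u 0 (2 * R) := by
    rw [← avgLpNorm_one]
    exact avgLpNorm_mono_exponent one_pos hp measurableSet_ball hu.aestronglyMeasurable 0
      (by positivity)
  calc _ ≤ ENNReal.ofReal ((2 * R) ^ μ) * (8 ^ d * avgLpNorm p (ball 0 R) u 0 (2 * R)) := by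
        gcongr
        · linarith
        · exact h1.trans (by gcongr)
    _ = 8 ^ d * (ENNReal.ofReal ((2 * R) ^ μ) * avgLpNorm p (ball 0 R) u 0 (2 * R)) := by ring
    _ ≤ _ := by
        gcongr
        exact le_iSup₂_of_le (2 * R) (by positivity) (le_iSup₂ (f := fun x
          (_ : x ∈ ball (0 : EuclideanSpace ℝ (Fin d)) R) =>
          ENNReal.ofReal ((2 * R) ^ μ) * avgLpNorm p (ball 0 R) u x (2 * R)) 0 h0)

end MorreyBounds

/-! ### The embedding at the limiting exponent. -/

section AdamsEmbedding

variable {d : ℕ} {R : ℝ}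
  {u : EuclideanSpace ℝ (Fin d) → ℝ} {Du : EuclideanSpace ℝ (Fin d) → EuclideanSpace ℝ (Fin d)}

theorem MemMorrey.integrableOn_ball {F : Type*} [NormedAddCommGroup F] {p μ : ℝ} (hp : 1 ≤ p)
    {g : EuclideanSpace ℝ (Fin d) → F} (hg : MemMorrey p μ (ball 0 R) g) :
    IntegrableOn g (ball 0 R) := by
  have : IsFiniteMeasure (volume.restrict (ball (0 : EuclideanSpace ℝ (Fin d)) R)) :=
    ⟨by simpa using measure_ball_lt_top⟩
  exact hg.memLp.integrable (by simpa using hp)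

/-- Adams' embedding on a ball at the limiting exponent. -/
theorem MemMorreyOne.morreyNorm_le (hd : d ≠ 0) (hR : 0 < R) {p μ s : ℝ} (hp : 1 < p)
    (hμ : 1 < μ) (hs : 1 ≤ s) (hps : s - s / μ = p) (hsd : (μ - 1) * s ≤ d)
    (h : MemMorreyOne p μ (ball 0 R) u Du) :
    morreyNorm s (μ - 1) (ball 0 R) u ≤
      adamsConst d p μ s * morreyNorm p μ (ball 0 R) Du +
        8 ^ d * (ENNReal.ofReal R)⁻¹ * morreyNorm p μ (ball 0 R) u := by
  obtain ⟨η, hη⟩ := exists_isBallWeight d hR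
  have hu := h.memMorrey.integrableOn_ball hp.le
  have hDu := h.memMorrey_grad.integrableOn_ball hp.le
  set c := ∫ z in ball 0 R, u z * η z with hc
  have hs0 : 0 < s := by linarith
  have hosc : morreyNorm s (μ - 1) (ball 0 R) (fun y => u y - c) ≤
      adamsConst d p μ s * morreyNorm p μ (ball 0 R) Du := by
    have hlt := h.memMorrey_grad.norm_lt_top
    -- Hedberg's bound needs K > 0, while the norm of Du may vanish; hence K = k + ε with ε → 0,
    -- using that the constant is finite.
    have hall : ∀ K : ℝ, 0 < K → morreyNorm p μ (ball 0 R) Du ≤ ENNReal.ofReal K →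
        morreyNorm s (μ - 1) (ball 0 R) (fun y => u y - c) ≤
          adamsConst d p μ s * ENNReal.ofReal K := by
      intro K hK0 hK
      refine iSup₂_le fun ρ hρ => iSup₂_le fun x hx => ?_
      calc _ ≤ ENNReal.ofReal (ρ ^ (μ - 1)) *
            (adamsConst d p μ s * ENNReal.ofReal (K * ρ ^ (-(μ - 1)))) := by
            gcongr
            exact hη.avgLpNorm_sub_le hd hR hu hDu h.hasWeakGradient hp hμ hs0 hps hK0 hK hx hρ
        _ = _ := by
            rw [mul_left_comm, ← ENNReal.ofReal_mul (by positivity), Real.rpow_neg hρ.le]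
            congr 2
            have : ρ ^ (μ - 1) ≠ 0 := by positivity
            field_simp
    set k := (morreyNorm p μ (ball 0 R) Du).toReal with hk
    have hk' : morreyNorm p μ (ball 0 R) Du = ENNReal.ofReal k :=
      (ENNReal.ofReal_toReal hlt.ne).symm
    have hk0 : 0 ≤ k := ENNReal.toReal_nonneg
    have hlim : Filter.Tendsto (fun ε : ℝ => adamsConst d p μ s * ENNReal.ofReal (k + ε))
        (nhdsWithin 0 (Ioi 0)) (nhds (adamsConst d p μ s * ENNReal.ofReal k)) := by
      refine ENNReal.Tendsto.const_mul ?_ (Or.inr (adamsConst_ne_top d hp hs0))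
      refine ENNReal.tendsto_ofReal ?_
      have : ContinuousAt (fun ε : ℝ => k + ε) 0 := by fun_prop
      simpa [ContinuousAt] using this.tendsto.mono_left (nhdsWithin_le_nhds (s := Ioi (0 : ℝ)))
    rw [hk']
    refine ge_of_tendsto hlim ?_
    filter_upwards [self_mem_nhdsWithin] with ε hε
    have hε : 0 < ε := hε
    refine hall _ (by linarith) ?_
    rw [hk']
    exact ENNReal.ofReal_le_ofReal (by linarith)
  have hconst : morreyNorm s (μ - 1) (ball (0 : EuclideanSpace ℝ (Fin d)) R) (fun _ => c) ≤
      8 ^ d * (ENNReal.ofReal R)⁻¹ * morreyNorm p μ (ball 0 R) u := by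
    refine (morreyNorm_const_ball_le hR hs0 (by linarith) hsd c).trans ?_
    calc ENNReal.ofReal (R ^ (μ - 1)) * ‖c‖ₑ
        = (ENNReal.ofReal R)⁻¹ * (ENNReal.ofReal (R ^ μ) * ‖c‖ₑ) := by
          rw [Real.rpow_sub_one hR.ne', ENNReal.ofReal_div_of_pos hR, div_eq_mul_inv]
          ring
      _ ≤ (ENNReal.ofReal R)⁻¹ * (8 ^ d * morreyNorm p μ (ball 0 R) u) := by
          gcongr _ * ?_
          exact hη.enorm_integral_mul_le (p := p) (μ := μ) hR hu hp.le (by linarith)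
      _ = _ := by ring
  have hsplit : u = (fun y => u y - c) + fun _ => c := by
    ext y; simp
  calc morreyNorm s (μ - 1) (ball 0 R) u
      = morreyNorm s (μ - 1) (ball 0 R) ((fun y => u y - c) + fun _ => c) := by rw [← hsplit]
    _ ≤ _ := (morreyNorm_add_le hs measurableSet_ball
        (hu.aestronglyMeasurable.sub aestronglyMeasurable_const)
        aestronglyMeasurable_const).trans (add_le_add hosc hconst)

end AdamsEmbedding

/-! ### All exponents up to the limiting one. -/

theorem lemma4p7 (d : ℕ) (p q : ℝ) (hp : 1 < p) (hpq : p < q) (hqd : q < (d : ℝ)) :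
    ∃ N : ℝ≥0, ∀ (R : ℝ), 0 < R → ∀ (p' : ℝ), 1 ≤ p' → p' ≤ p * q / (q - p) →
      ∀ (u : EuclideanSpace ℝ (Fin d) → ℝ)
        (Du : EuclideanSpace ℝ (Fin d) → EuclideanSpace ℝ (Fin d)),
        MemMorreyOne p (q / p) (ball (0 : EuclideanSpace ℝ (Fin d)) R) u Du →
        MemMorrey p' (q / p - 1) (ball (0 : EuclideanSpace ℝ (Fin d)) R) u ∧
          morreyNorm p' (q / p - 1) (ball (0 : EuclideanSpace ℝ (Fin d)) R) u ≤
            (N : ℝ≥0∞) * morreyNorm p (q / p) (ball (0 : EuclideanSpace ℝ (Fin d)) R) Du +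
              (N : ℝ≥0∞) * (ENNReal.ofReal R)⁻¹ *
                morreyNorm p (q / p) (ball (0 : EuclideanSpace ℝ (Fin d)) R) u := by
  have hp0 : 0 < p := by linarith
  have hq0 : 0 < q := by linarith
  have hqp : 0 < q - p := by linarith
  have hd : d ≠ 0 := by
    rintro rfl
    simp at hqd
    linarith
  set s := p * q / (q - p) with hs
  have hμ : 1 < q / p := (one_lt_div hp0).2 hpq
  -- This identity singles out q' as the limiting exponent; the companion identity (μ - 1)q' = q < d
  -- admits constants.
  have hps : s - s / (q / p) = p := by
    rw [hs]; field_simp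
  have hsd : (q / p - 1) * s ≤ d := by
    have : (q / p - 1) * s = q := by rw [hs]; field_simp
    linarith
  have hs0 : 0 < s := by positivity
  have hs1 : 1 ≤ s := by
    have : 0 < s / (q / p) := by positivity
    linarith
  have hCt := adamsConst_ne_top d (μ := q / p) hp hs0
  -- The sum dominates both coefficients. It does not involve p', since lowering the exponent in a
  -- normalized average costs no constant.
  refine ⟨(adamsConst d p (q / p) s).toNNReal + 8 ^ d, fun R hR p' hp1 hps' u Du h => ?_⟩
  have hm := h.memMorrey.integrableOn_ball hp.le |>.aestronglyMeasurable
  have hle : morreyNorm p' (q / p - 1) (ball 0 R) u ≤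
      adamsConst d p (q / p) s * morreyNorm p (q / p) (ball 0 R) Du +
        8 ^ d * (ENNReal.ofReal R)⁻¹ * morreyNorm p (q / p) (ball 0 R) u :=
    (morreyNorm_mono_exponent (by linarith) hps' _ measurableSet_ball hm).trans
      (h.morreyNorm_le hd hR hp hμ hs1 hps hsd)
  have hfin : morreyNorm p' (q / p - 1) (ball 0 R) u < ⊤ := by
    have h1 := h.memMorrey.norm_lt_top
    have h2 := h.memMorrey_grad.norm_lt_top
    have h3 : (ENNReal.ofReal R)⁻¹ ≠ ⊤ := by simpa using hR
    refine hle.trans_lt ?_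
    finiteness
  refine ⟨⟨memLp_of_morreyNorm_lt_top hR (by linarith) hm hfin, hfin⟩, hle.trans ?_⟩
  rw [ENNReal.coe_add, ENNReal.coe_toNNReal hCt]
  gcongr
  · exact le_self_add
  · push_cast
    exact le_add_self
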